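/- **Frobenius potentials.** For $N\ge 1$ let $\Lambda=\frac{x^{N+1}}{N+1}+y^2+\sum_{k=1}^N v_kx^{k-1}$ be the unfolding of the $A_N$ singularity. The ring $\mathbb C[x,y]/(\partial_x\Lambda,\partial_y\Lambda)$ has the basis $\partial\Lambda/\partial v_k=x^{k-1}$, $1\le k\le N$; identifying $\partial/\partial v_k$ with $\partial\Lambda/\partial v_k$, one gets a product $\circ$ on vector fields in $v$ and the pairing $\eta$, where $\eta(a,b)$ is the coefficient of $x^{N-1}$ in $a\circ b$. Let $t_1,\dots,t_N$ be the flat coordinates, with $v_k\in\mathbb C[t_1,\dots,t_N]$ normalized by $v_k=t_k+(\text{terms of order}\ge 2)$ and $\eta(\partial/\partial t_\alpha,\partial/\partial t_\beta)=\delta_{\alpha+\beta,N+1}$, and let $F_{A_N}\in\mathbb C[t_1,\dots,t_N]$ be the (unique) polynomial with $$\frac{\partial}{\partial t_\alpha}\circ\frac{\partial}{\partial t_\beta}=\sum_{\gamma=1}^N\frac{\partial^3F_{A_N}}{\partial t_\alpha\partial t_\beta\partial t_\gamma}\frac{\partial}{\partial t_{N+1-\gamma}},\qquad \sum_{\alpha=1}^N\frac{N+2-\alpha}{N+1}\,t_\alpha\frac{\partial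 F_{A_N}}{\partial t_\alpha}=\Bigl(3-\frac{N-1}{N+1}\Bigr)F_{A_N}.$$ Put $F_{B_N}(t_1,\dots,t_N)=F_{A_{2N-1}}(t_1,0,t_2,0,\dots,0,t_N)$. **Hierarchy of type $B$.** For $\alpha,\beta,m,\gamma_1,\dots,\gamma_m\ge 1$ with $\gamma_1+\dots+\gamma_m=\alpha+\beta-1$ put, with $N=\alpha+\beta+1$, $$R^{\mathrm B}_{\alpha,\beta;\gamma_1,\dots,\gamma_m}=\frac1{m!}\left.\frac{\partial^{m+2}F_{B_N}}{\partial t_\alpha\,\partial t_\beta\,\partial t_{N+1-\gamma_1}\cdots\partial t_{N+1-\gamma_m}}\right|_{t=0},$$ and consider the system of PDEs on $f=f(t_1,t_2,t_3,\dots)$ $$\partial_\alpha\partial_\beta f=\sum_{m\ge1}\ \sum_{\gamma_1+\dots+\gamma_m=\alpha+\beta-1}R^{\mathrm B}_{\alpha,\beta;\gamma_1,\dots,\gamma_m}\,\partial_1\partial_{\gamma_1}f\cdots\partial_1\partial_{\gamma_m}f\qquad(\alpha,\beta\ge1).\tag{B}$$ **Dispersionless BKP hierarchy.** For $F_0=F_0(t_1,t_3,t_5,\dots)$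 and $D^{\mathrm B}(z)=\sum_{n\ge0}\frac{z^{-2n-1}}{2n+1}\partial_{2n+1}$ it is the following identity of formal series in $z_1^{-1},z_2^{-1}$: $$\left(1-\frac{\partial_1(2D^{\mathrm B}(z_1)+2D^{\mathrm B}(z_2))F_0}{z_1+z_2}\right)e^{2D^{\mathrm B}(z_1)\cdot 2D^{\mathrm B}(z_2)F_0}=1-\frac{\partial_1(2D^{\mathrm B}(z_1)-2D^{\mathrm B}(z_2))F_0}{z_1-z_2}.\tag{BKP-dl}$$ **Theorem.** The system (B) coincides with the dispersionless BKP hierarchy (BKP-dl) after the change of variables $t_k\mapsto t_{2k-1}/(2k-1)$ and the substitution $f\mapsto 2F_0$. That is, a formal power series $F_0(t_1,t_3,t_5,\dots)$ over $\mathbb C$ satisfies (BKP-dl) if and only if the series $f(t_1,t_2,t_3,\dots)=2F_0\bigl(t_1,\tfrac{t_2}{3},\tfrac{t_3}{5},\dots\bigr)$, obtained from $2F_0$ by replacing every $t_{2k-1}$ by $t_k/(2k-1)$, satisfies (B). -/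

import Mathlib

/-!
All variables are numbered from `0` where a type of variables is concerned: in the polynomial ring
over `Fin N` the variable `i` is `t_{i+1}` (or `v_{i+1}`), in the ring of power series in which `f`
lives the variable `n : ℕ` is `t_{n+1}`, and in the ring in which `F₀` lives (only odd times) the
variable `n : ℕ` is `t_{2n+1}`.
-/

noncomputable section

namespace Frob

/-! ### The Frobenius manifold of the `A_N` singularity -/

/-- The polynomial ring `ℂ[t_1, …, t_N]`. -/
abbrev Poly (N : ℕ) : Type := MvPolynomial (Fin N) ℂ

/-- The unfolding `Λ = x^{N+1}/(N+1) + ∑_k v_k x^{k-1}` of the `A_N` singularity, as a polynomial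
in `x`, where the unfolding parameters `v_k` are polynomials in coordinates `t_1, …, t_N`.
(The square `y²` is omitted: its partial derivative `2y` eliminates `y` from the Jacobian ring.) -/
def unfolding (N : ℕ) (v : Fin N → Poly N) : Polynomial (Poly N) :=
  Polynomial.C (MvPolynomial.C (1 / ((N : ℂ) + 1))) * Polynomial.X ^ (N + 1)
    + ∑ k : Fin N, Polynomial.C (v k) * Polynomial.X ^ (k : ℕ)

/-- The polynomial `∂Λ/∂x`, which generates the Jacobian ideal. -/
def unfoldingDeriv (N : ℕ) (v : Fin N → Poly N) : Polynomial (Poly N) :=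
  Polynomial.derivative (unfolding N v)

/-- `∂Λ/∂x` is monic of degree `N`, so that division with remainder by it makes sense and
`1, x, …, x^{N-1}` is a basis of the Jacobian ring. -/
theorem unfoldingDeriv_monic (N : ℕ) (v : Fin N → Poly N) :
    (unfoldingDeriv N v).Monic ∧ (unfoldingDeriv N v).natDegree = N := by
  have h0 : unfoldingDeriv N v = Polynomial.X ^ N
      + ∑ k : Fin N, Polynomial.derivative (Polynomial.C (v k) * Polynomial.X ^ (k : ℕ)) := by
    have hN : (N : ℂ) + 1 ≠ 0 := by exact_mod_cast Nat.succ_ne_zero N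
    have h1 : (MvPolynomial.C (1 / ((N : ℂ) + 1)) : Poly N) * ((N : Poly N) + 1) = 1 := by
      rw [← map_natCast (MvPolynomial.C (R := ℂ) (σ := Fin N)) N, ← map_one MvPolynomial.C,
        ← map_add, ← map_mul]
      congr 1
      field_simp
    simp only [unfoldingDeriv, unfolding, map_add, map_sum, Polynomial.derivative_C_mul,
      Polynomial.derivative_X_pow, Nat.add_sub_cancel]
    rw [← mul_assoc, ← Polynomial.C_mul, Nat.cast_add, Nat.cast_one, h1]
    simp
  have hlt : (∑ k : Fin N, Polynomial.derivative
      (Polynomial.C (v k) * Polynomial.X ^ (k : ℕ))).degree < (N : WithBot ℕ) := by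
    refine lt_of_le_of_lt (Polynomial.degree_sum_le _ _)
      ((Finset.sup_lt_iff (WithBot.bot_lt_coe N)).2 ?_)
    intro k _
    refine lt_of_le_of_lt (Polynomial.degree_derivative_le) ?_
    refine lt_of_le_of_lt (Polynomial.degree_C_mul_X_pow_le _ _) ?_
    exact WithBot.coe_lt_coe.2 k.2
  rw [h0]
  exact ⟨Polynomial.monic_X_pow_add hlt,
    by rw [Polynomial.natDegree_add_eq_left_of_degree_lt (by simpa using hlt),
      Polynomial.natDegree_X_pow]⟩

/-- `∂Λ/∂t_α = ∑_k (∂v_k/∂t_α) x^{k-1}`: the element of the Jacobian ring that represents the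
vector field `∂/∂t_α`. -/
def tangent (N : ℕ) (v : Fin N → Poly N) (α : Fin N) : Polynomial (Poly N) :=
  ∑ k : Fin N, Polynomial.C (MvPolynomial.pderiv α (v k)) * Polynomial.X ^ (k : ℕ)

/-- The product of two elements of the Jacobian ring, as a combination of the basis elements
`∂Λ/∂v_k = x^{k-1}`, `1 ≤ k ≤ N`. -/
def circ (N : ℕ) (v : Fin N → Poly N) (a b : Polynomial (Poly N)) : Polynomial (Poly N) :=
  (a * b) %ₘ unfoldingDeriv N v

/-- The residue pairing: the coefficient of `∂Λ/∂v_N = x^{N-1}` in the product. -/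
def eta (N : ℕ) (v : Fin N → Poly N) (a b : Polynomial (Poly N)) : Poly N :=
  (circ N v a b).coeff (N - 1)

/-- `v = v(t)` expresses the unfolding parameters through flat coordinates `t`, normalized by
`v_k = t_k + (terms of order at least two)` and by `η(∂/∂t_α, ∂/∂t_β) = δ_{α+β,N+1}`. -/
structure IsFlat (N : ℕ) (v : Fin N → Poly N) : Prop where
  constantCoeff_eq : ∀ k, MvPolynomial.constantCoeff (v k) = 0
  linear_eq : ∀ k α, MvPolynomial.coeff (Finsupp.single α 1) (v k) = if α = k then 1 else 0
  eta_eq : ∀ α β, eta N v (tangent N v α) (tangent N v β) = if β = α.rev then 1 else 0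

/-- `F` is the potential of the `A_N` Frobenius manifold in the normalized flat coordinates:
`∂/∂t_α ∘ ∂/∂t_β = ∑_{γ,δ} (∂³F/∂t_α∂t_β∂t_γ) η^{γδ} ∂/∂t_δ`, and `E·F = (3 - δ) F` for
`E = ∑_α (N+2-α)/(N+1) t_α ∂/∂t_α` and `δ = (N-1)/(N+1)`. -/
def IsPotentialA (N : ℕ) (F : Poly N) : Prop :=
  (∃ v : Fin N → Poly N, IsFlat N v ∧
    ∀ α β, circ N v (tangent N v α) (tangent N v β) =
      ∑ γ : Fin N, Polynomial.C (MvPolynomial.pderiv α (MvPolynomial.pderiv β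
        (MvPolynomial.pderiv γ F))) * tangent N v γ.rev) ∧
  ∑ α : Fin N, MvPolynomial.C (((N : ℂ) + 1 - (α : ℕ)) / ((N : ℂ) + 1)) *
      (MvPolynomial.X α * MvPolynomial.pderiv α F) =
    MvPolynomial.C (3 - ((N : ℂ) - 1) / ((N : ℂ) + 1)) * F

open Classical in
/-- The potential `F_{A_N}`: the unique polynomial with the property `IsPotentialA N`. -/
def FA (N : ℕ) : Poly N :=
  if h : ∃! F : Poly N, IsPotentialA N F then h.choose else 0

/-- `F_{B_N}(t_1, …, t_N) = F_{A_{2N-1}}(t_1, 0, t_2, 0, …, 0, t_N)`. -/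
def FB (N : ℕ) : Poly N :=
  MvPolynomial.aeval (fun j : Fin (2 * N - 1) =>
    if (j : ℕ) % 2 = 0 then (MvPolynomial.X ⟨(j : ℕ) / 2, by omega⟩ : Poly N) else 0)
    (FA (2 * N - 1))

/-! ### The hierarchy of type `B` -/

/-- `∂/∂t_a` on `ℂ[t_1, …, t_N]` for `1 ≤ a ≤ N`. -/
def dPoly (N a : ℕ) (P : Poly N) : Poly N :=
  if h : 1 ≤ a ∧ a ≤ N then MvPolynomial.pderiv (⟨a - 1, by omega⟩ : Fin N) P else 0

/-- `R^{(B_N)}_{α,β;γ_1,…,γ_m} = (1/m!) ∂^{m+2}F_{B_N} / ∂t_α ∂t_β ∂t_{N+1-γ_1} ⋯ ∂t_{N+1-γ_m}`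
at `t = 0`. -/
def RBN (N α β : ℕ) (γ : List ℕ) : ℂ :=
  1 / (γ.length.factorial : ℂ) * MvPolynomial.constantCoeff
    (γ.foldr (fun g P => dPoly N (N + 1 - g) P) (dPoly N α (dPoly N β (FB N))))

/-- `R^B_{α,β;γ_1,…,γ_m} = R^{(B_{α+β+1})}_{α,β;γ_1,…,γ_m}`. -/
def RB (α β : ℕ) (γ : List ℕ) : ℂ := RBN (α + β + 1) α β γ

/-- Formal power series over `ℂ` in infinitely many times. -/
abbrev TSeries : Type := MvPowerSeries ℕ ℂ

/-- `∂_k = ∂/∂t_k`, `k ≥ 1`, on power series in `t_1, t_2, t_3, …`. -/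
def dT (k : ℕ) (f : TSeries) : TSeries := MvPowerSeries.pderiv ℂ (k - 1) f

/-- The system
`∂_α ∂_β f = ∑_{m ≥ 1} ∑_{γ_1+…+γ_m = α+β-1} R^B_{α,β;γ_1,…,γ_m} ∂_1∂_{γ_1} f ⋯ ∂_1∂_{γ_m} f`
for all `α, β ≥ 1`. The sum runs over the compositions of `α+β-1`, that is, over
the finite sequences of positive integers with this sum. -/
def SolvesBHierarchy (f : TSeries) : Prop :=
  ∀ α β : ℕ, 1 ≤ α → 1 ≤ β →
    dT α (dT β f) = ∑ γ : Composition (α + β - 1),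
      RB α β γ.blocks • (γ.blocks.map fun g => dT 1 (dT g f)).prod

/-! ### The dispersionless BKP hierarchy -/

/-- `∂_{2n+1} = ∂/∂t_{2n+1}` on power series in the odd times `t_1, t_3, t_5, …`. -/
def dOdd (n : ℕ) (F : TSeries) : TSeries := MvPowerSeries.pderiv ℂ n F

/-- Power series in `z_1^{-1}` (variable `0`) and `z_2^{-1}` (variable `1`) whose coefficients are
power series in the times. -/
abbrev ZSeries : Type := MvPowerSeries (Fin 2) TSeries

/-- `∂_1` acting on the coefficients of a series in `z_1^{-1}, z_2^{-1}`. -/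
def dFirst (G : ZSeries) : ZSeries := fun d => dOdd 0 (MvPowerSeries.coeff d G)

/-- The operator `D^B(z) = ∑_{n ≥ 0} z^{-2n-1}/(2n+1) ∂_{2n+1}` for `z = z_1` (`i = 0`) or `z = z_2`
(`i = 1`), through the coefficients of the resulting series. -/
def DB (i : Fin 2) (G : ZSeries) : ZSeries := fun d =>
  ∑ n ∈ Finset.range (d i), if 2 * n + 1 ≤ d i then
    (1 / (2 * (n : ℂ) + 1)) •
      dOdd n (MvPowerSeries.coeff (d - Finsupp.single i (2 * n + 1)) G) else 0

/-- The exponential of a series without constant term. -/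
def expZ (G : ZSeries) : ZSeries := (PowerSeries.exp ℂ).subst G

/-- The field of fractions of the domain of power series in `z_1^{-1}, z_2^{-1}`. -/
abbrev ZField : Type := FractionRing ZSeries

/-- A power series as an element of the field of fractions. -/
def toF (G : ZSeries) : ZField := algebraMap ZSeries ZField G

/-- `z_1` (`i = 0`) and `z_2` (`i = 1`). -/
def z (i : Fin 2) : ZField := (toF (MvPowerSeries.X i))⁻¹

/-- The dispersionless BKP hierarchy
`(1 - ∂_1(2D(z_1)+2D(z_2))F₀/(z_1+z_2)) exp(2D(z_1)·2D(z_2)F₀) = 1 - ∂_1(2D(z_1)-2D(z_2))F₀/(z_1-z_2)`,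
`D = D^B`. -/
def SolvesDispersionlessBKP (F₀ : TSeries) : Prop :=
  let G : ZSeries := MvPowerSeries.C F₀
  (1 - toF (dFirst (2 * DB 0 G + 2 * DB 1 G)) / (z 0 + z 1)) *
      toF (expZ (2 * DB 0 (2 * DB 1 G))) =
    1 - toF (dFirst (2 * DB 0 G - 2 * DB 1 G)) / (z 0 - z 1)

/-- `f(t_1, t_2, t_3, …) = 2 F₀(t_1, t_2/3, t_3/5, …)`: the time `t_{2k-1}` of `F₀` is replaced
by `t_k/(2k-1)`, and the result is multiplied by two. -/
def changeOfVariables (F₀ : TSeries) : TSeries :=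
  2 * MvPowerSeries.rescale (fun n : ℕ => 1 / (2 * (n : ℂ) + 1)) F₀

end Frob

end

/-! Both systems reduce to one formula. Put w_i = 1/z_i, A = 1 + w₀w₁ ∑_g s_g (w₀^{g+1} -
w₁^{g+1})/(w₀ - w₁) and L = θA/A, where θ is the Euler operator in w₀, w₁. Let f_{nm} = 2
∂_{2n+1}∂_{2m+1}F₀ / ((2n+1)(2m+1)), s_{2m} = f_{0m}, and s_g = 0 for odd g. Each system says that
2(n+m+1) f_{nm} is the coefficient of w₀^{2n+1} w₁^{2m+1} in L, for all n, m.

Singularity side. The polynomials with ∑ Q_n w^n = 1/(1 - xw - ∑_{g≥1} t_{N+1-g} w^{g+1}) make the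
flat coordinates explicit: Q_N = ∂Λ/∂x, and Q_0, …, Q_{N-1} are the ∂Λ/∂t_α. Derivatives in x and in
every t_α are shifts of the square of this generating function (`dt_Q_eq_derivative`), which gives
Λ; exchanging indices in products (`Q_mul_Q_sub_mem`) gives the pairing and the quotients modulo
Q_N. The structure constants are then closed and homogeneous (`pderiv_sc`, `euler_sc`), so three
integrations along the Euler field produce the potential. A Koszul formula determines the flat
coordinates order by order (`IsFlat.eq_flatV`), so the potential is unique and `FA` is this one.

By homogeneity, ∂_a∂_bF times its weight is the residue of Q_a Q_b E, with E the Euler field. The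
recursion of the Q_n turns this into `SecondDerRec`, a recursion in a, b which determines these
second derivatives as polynomials in the reversed coordinates. The sum over compositions in (B) is
the Taylor expansion of such a second derivative, evaluated at s (`sum_RB`).

BKP side. The coefficients of L satisfy the same recursion (`secondDerRec_kernelL`), hence equal the
weighted right-hand sides of (B). After clearing denominators (BKP-dl) reads A(w₀,-w₁) exp(Ψ) =
A(w₀,w₁) with Ψ = 2D(z₁)·2D(z₂)F₀; its logarithmic derivative is θΨ = L(w₀,w₁) - L(w₀,-w₁), which
has content only where both exponents are odd. -/

noncomputable section

namespace Frob

open Finset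

/-! ### Sequences with generating function `1 / (1 - ∑ σ_i w^{i+1})` -/

section RecSeq

variable {B : Type*} [CommRing B]

/-- The coefficients of `1 / (1 - ∑ σ_i w^{i+1})`. -/
def recSeq (σ : ℕ → B) : ℕ → B
  | 0 => 1
  | n + 1 => ∑ i : Fin (n + 1), σ i * recSeq σ (n - i)

theorem recSeq_zero (σ : ℕ → B) : recSeq σ 0 = 1 := by rw [recSeq]

theorem recSeq_succ (σ : ℕ → B) (n : ℕ) :
    recSeq σ (n + 1) = ∑ i ∈ range (n + 1), σ i * recSeq σ (n - i) := by
  rw [recSeq, Finset.sum_range (fun i => σ i * recSeq σ (n - i))]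

/-- The coefficients of `1 / (1 - ∑ σ_i w^{i+1}) ^ 2`. -/
def recSq (σ : ℕ → B) (n : ℕ) : B :=
  ∑ p ∈ antidiagonal n, recSeq σ p.1 * recSeq σ p.2

theorem recSq_zero (σ : ℕ → B) : recSq σ 0 = 1 := by
  simp [recSq, recSeq_zero]

/-- The generating function q satisfies q = 1 + wσq; multiply by q. -/
theorem recSq_succ (σ : ℕ → B) (n : ℕ) :
    recSq σ (n + 1) = recSeq σ (n + 1) + ∑ i ∈ range (n + 1), σ i * recSq σ (n - i) := by
  have hq : PowerSeries.mk (recSeq σ) =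
      1 + PowerSeries.X * (PowerSeries.mk σ * PowerSeries.mk (recSeq σ)) := by
    ext k
    cases k with
    | zero => simp [recSeq_zero]
    | succ k =>
      rw [map_add, PowerSeries.coeff_succ_X_mul, PowerSeries.coeff_mul, PowerSeries.coeff_mk,
        recSeq_succ, PowerSeries.coeff_one]
      simp only [PowerSeries.coeff_mk]
      rw [Finset.Nat.sum_antidiagonal_eq_sum_range_succ (fun i j => σ i * recSeq σ j)]
      simp
  have hsq : ∀ k, recSq σ k =
      PowerSeries.coeff k (PowerSeries.mk (recSeq σ) * PowerSeries.mk (recSeq σ)) := by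
    intro k
    simp [recSq, PowerSeries.coeff_mul]
  have h2 : PowerSeries.mk (recSeq σ) * PowerSeries.mk (recSeq σ) = PowerSeries.mk (recSeq σ) +
      PowerSeries.X * (PowerSeries.mk σ * (PowerSeries.mk (recSeq σ) *
        PowerSeries.mk (recSeq σ))) := by
    linear_combination PowerSeries.mk (recSeq σ) * hq
  rw [hsq, h2, map_add, PowerSeries.coeff_succ_X_mul, PowerSeries.coeff_mul,
    Finset.Nat.sum_antidiagonal_eq_sum_range_succ (fun i j => PowerSeries.coeff i (PowerSeries.mk σ)
      * PowerSeries.coeff j (PowerSeries.mk (recSeq σ) * PowerSeries.mk (recSeq σ)))]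
  simp [← hsq]

/-- In generating functions: from q = 1/(1 - ∑ σ_i w^{i+1}) one gets Dq = w^{j+1} q². -/
theorem derivation_recSeq {R : Type*} [CommRing R] [Algebra R B] (D : Derivation R B B)
    (σ : ℕ → B) (j : ℕ) (hD : ∀ i, D (σ i) = if i = j then 1 else 0) (n : ℕ) :
    D (recSeq σ n) = if j + 1 ≤ n then recSq σ (n - 1 - j) else 0 := by
  induction n using Nat.strong_induction_on with
  | _ n ih =>
    cases n with
    | zero => simp [recSeq_zero]
    | succ n =>
      rw [recSeq_succ, map_sum]
      -- The Leibniz rule gives one term where D hits σ_j, and terms with the inductive value of D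
      -- on the earlier coefficient, which vanish once i ≥ n - j.
      have h1 : ∀ i ∈ range (n + 1), D (σ i * recSeq σ (n - i)) =
          (if i = j then recSeq σ (n - j) else 0) +
            (if i ∈ range (n - j) then σ i * recSq σ (n - j - 1 - i) else 0) := by
        intro i hi
        rw [Derivation.leibniz, hD, ih _ (by omega)]
        simp only [smul_eq_mul, mem_range] at hi ⊢
        rw [add_comm]
        congr 1
        · split_ifs with h
          · simp [h]
          · simp
        · by_cases h : i < n - j
          · rw [if_pos (by omega), if_pos h]
            congr 2
            omega
          · rw [if_neg (by omega), if_neg h, mul_zero]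
      rw [Finset.sum_congr rfl h1, Finset.sum_add_distrib, Finset.sum_ite_eq', ← Finset.sum_filter]
      by_cases hj : j ≤ n
      · rw [if_pos (by simpa using Nat.lt_succ_of_le hj), if_pos (by omega)]
        have h2 : (range (n + 1)).filter (· ∈ range (n - j)) = range (n - j) := by
          ext i
          simp only [mem_filter, mem_range]
          omega
        rw [h2, Nat.add_sub_cancel]
        obtain ⟨m, hm⟩ : ∃ m, n - j = m := ⟨_, rfl⟩
        rw [hm]
        cases m with
        | zero => simp [recSq_zero, recSeq_zero]
        | succ m => rw [recSq_succ, Nat.add_sub_cancel]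
      · rw [if_neg (by simpa using hj), if_neg (by omega), Finset.sum_eq_zero, add_zero]
        intro i hi
        simp only [mem_filter, mem_range] at hi
        omega

/-- Giving σ_i weight i + 1 makes ∑ σ_i w^{i+1} invariant under scaling with w of weight -1, so the
n-th coefficient is homogeneous of weight n. -/
theorem euler_recSeq {R : Type*} [CommRing R] [Algebra R B] (D : Derivation R B B)
    (σ : ℕ → B) (hD : ∀ i, D (σ i) = ((i : B) + 1) * σ i) (n : ℕ) :
    D (recSeq σ n) = n * recSeq σ n := by
  induction n using Nat.strong_induction_on with
  | _ n ih =>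
    cases n with
    | zero => simp [recSeq_zero]
    | succ n =>
      rw [recSeq_succ, map_sum, Finset.mul_sum]
      refine Finset.sum_congr rfl fun i hi => ?_
      rw [mem_range] at hi
      rw [Derivation.leibniz, hD, ih _ (by omega), Nat.cast_sub (by omega)]
      simp only [smul_eq_mul, Nat.cast_add, Nat.cast_one]
      ring

end RecSeq

/-! ### Derivations acting on the coefficients of polynomials -/

section MapCoeff

variable {R A : Type*} [CommRing R] [CommRing A] [Algebra R A]

/-- The action of a derivation on the coefficients of polynomials. -/
def coeffDer (d : Derivation R A A) : Derivation R (Polynomial A) (Polynomial A) :=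
  (PolynomialModule.equivPolynomialSelf.toLinearMap).compDer d.mapCoeffs

theorem coeff_coeffDer (d : Derivation R A A) (p : Polynomial A) (n : ℕ) :
    (coeffDer d p).coeff n = d (p.coeff n) := rfl

@[simp]
theorem coeffDer_C (d : Derivation R A A) (a : A) :
    coeffDer d (Polynomial.C a) = Polynomial.C (d a) := by
  ext n
  rw [coeff_coeffDer, Polynomial.coeff_C, Polynomial.coeff_C]
  split_ifs <;> simp

@[simp]
theorem coeffDer_X (d : Derivation R A A) : coeffDer d Polynomial.X = 0 := by
  ext n
  rw [coeff_coeffDer, Polynomial.coeff_X]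
  split_ifs <;> simp

theorem coeffDer_derivative (d : Derivation R A A) (p : Polynomial A) :
    coeffDer d (Polynomial.derivative p) = Polynomial.derivative (coeffDer d p) := by
  ext n
  rw [coeff_coeffDer, Polynomial.coeff_derivative, Polynomial.coeff_derivative, coeff_coeffDer,
    Derivation.leibniz]
  simp [mul_comm]

theorem degree_coeffDer_lt (d : Derivation R A A) {p : Polynomial A} {n : ℕ}
    (hp : p.degree < n) : (coeffDer d p).degree < n := by
  rw [Polynomial.degree_lt_iff_coeff_zero] at hp ⊢
  intro m hm
  rw [coeff_coeffDer, hp m hm, map_zero]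

end MapCoeff

/-- The derivation `∂/∂t_α` on the coefficients of polynomials in `x`. -/
abbrev dt {N : ℕ} (α : Fin N) : Derivation ℂ (Polynomial (Poly N)) (Polynomial (Poly N)) :=
  coeffDer (MvPolynomial.pderiv α)

theorem pderiv_comm {σ : Type*} (i j : σ) (p : MvPolynomial σ ℂ) :
    MvPolynomial.pderiv i (MvPolynomial.pderiv j p) =
      MvPolynomial.pderiv j (MvPolynomial.pderiv i p) := by
  classical
  ext m
  simp only [MvPolynomial.coeff_pderiv, Finsupp.add_apply]
  rw [add_right_comm]
  by_cases h : i = j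
  · subst h; rfl
  · rw [Finsupp.single_eq_of_ne h, Finsupp.single_eq_of_ne (Ne.symm h), add_zero, add_zero]
    exact mul_right_comm _ _ _

theorem dt_comm {N : ℕ} (α β : Fin N) (p : Polynomial (Poly N)) :
    dt α (dt β p) = dt β (dt α p) := by
  ext1 n
  simp only [coeff_coeffDer]
  rw [pderiv_comm]

/-- The weight `N + 2 - α` of the flat coordinate `t_α`, times `N + 1`, as an integer. -/
def wt {N : ℕ} (α : Fin N) : ℕ := N + 1 - α

/-- The Euler vector field (multiplied by `N + 1`). -/
def euler (N : ℕ) : Derivation ℂ (Poly N) (Poly N) :=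
  ∑ α : Fin N, ((wt α : Poly N) * MvPolynomial.X α) • MvPolynomial.pderiv α

theorem euler_apply (N : ℕ) (p : Poly N) : euler N p =
    ∑ α : Fin N, (wt α : Poly N) * MvPolynomial.X α * MvPolynomial.pderiv α p := by
  rw [euler, ← Derivation.coeFnAddMonoidHom_apply, map_sum, Finset.sum_apply]
  simp [Derivation.coeFnAddMonoidHom_apply]

theorem euler_X {N : ℕ} (α : Fin N) :
    euler N (MvPolynomial.X α) = (wt α : Poly N) * MvPolynomial.X α := by
  classical
  rw [euler_apply, Finset.sum_eq_single α]
  · simp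
  · intro b _ hb
    rw [MvPolynomial.pderiv_X_of_ne (Ne.symm hb), mul_zero]
  · simp

/-! ### The polynomials `∂Λ/∂t_α` in flat coordinates -/

/-- The coordinate `t_{N+1-g}` for `1 ≤ g ≤ N`. -/
def sv (N g : ℕ) : Poly N :=
  if h : 1 ≤ g ∧ g ≤ N then MvPolynomial.X ⟨N - g, by omega⟩ else 0

/-- The polynomial variable, followed by the reversed flat coordinates. -/
def sig (N g : ℕ) : Polynomial (Poly N) :=
  if g = 0 then Polynomial.X else Polynomial.C (sv N g)

/-- `Q_n`, with `Q_0 = 1` and `Q_{n+1} = x Q_n + ∑_g t_{N+1-g} Q_{n-g}`. For `n < N` it is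
`∂Λ/∂t_{n+1}`, and `Q_N = ∂Λ/∂x`. -/
def Q (N n : ℕ) : Polynomial (Poly N) := recSeq (sig N) n

theorem Q_zero (N : ℕ) : Q N 0 = 1 := recSeq_zero _

theorem Q_succ (N n : ℕ) : Q N (n + 1) = Polynomial.X * Q N n +
    ∑ g ∈ range n, Polynomial.C (sv N (g + 1)) * Q N (n - (g + 1)) := by
  rw [Q, recSeq_succ, Finset.sum_range_succ', add_comm]
  simp [sig, Q]

theorem pderiv_sv {N : ℕ} (α : Fin N) (g : ℕ) :
    MvPolynomial.pderiv α (sv N g) = if g = N - α then 1 else 0 := by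
  have := α.2
  unfold sv
  split_ifs with h1 h2 h2
  · have : (⟨N - g, by omega⟩ : Fin N) = α := by ext; simp; omega
    rw [this, MvPolynomial.pderiv_X_self]
  · rw [MvPolynomial.pderiv_X_of_ne]
    intro h
    apply h2
    have := congrArg Fin.val h
    simp at this
    omega
  · omega
  · simp

/-- The coordinate with index α is the entry N - α of `sig`, so ∂/∂t_α multiplies the squared
generating function by w^{N-α+1}. -/
theorem dt_Q {N : ℕ} (α : Fin N) (n : ℕ) :
    dt α (Q N n) = if N + 1 ≤ n + α then recSq (sig N) (n + α - N - 1) else 0 := by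
  have hα := α.2
  rw [Q, derivation_recSeq (dt α) (sig N) (N - α)]
  · congr 1
    · simp only [eq_iff_iff]; omega
    · congr 1; omega
  · intro i
    unfold sig
    split_ifs with h1 h2 h2
    · omega
    · simp
    · rw [coeffDer_C, pderiv_sv, if_pos h2, map_one]
    · rw [coeffDer_C, pderiv_sv, if_neg h2, map_zero]

/-- The variable x is the entry 0 of `sig`, so d/dx acts by the same formula with shift w. -/
theorem derivative_Q (N n : ℕ) :
    Polynomial.derivative (Q N n) = if 1 ≤ n then recSq (sig N) (n - 1) else 0 := by
  have := derivation_recSeq (Polynomial.derivative' (R := Poly N)) (sig N) 0 (by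
    intro i
    unfold sig
    split_ifs with h1 <;> simp) n
  simpa [Q] using this

/-- `∂Q_β/∂t_α` is the `x`-derivative of `Q_{α+β-N}`. -/
theorem dt_Q_eq_derivative {N : ℕ} (α : Fin N) (n : ℕ) :
    dt α (Q N n) = if N ≤ n + α then Polynomial.derivative (Q N (n + α - N)) else 0 := by
  rw [dt_Q, derivative_Q]
  by_cases h : N + 1 ≤ n + α
  · rw [if_pos h, if_pos (by omega), if_pos (by omega)]
  · rw [if_neg h]
    split_ifs <;> first | rfl | omega

/-- This closedness allows the Q_α to be the partial derivatives of a single function Λ. -/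
theorem dt_Q_symm {N : ℕ} (α β : Fin N) : dt α (Q N β) = dt β (Q N α) := by
  rw [dt_Q, dt_Q, add_comm (β : ℕ)]

theorem dt_Q_top {N : ℕ} (α : Fin N) : dt α (Q N N) = Polynomial.derivative (Q N α) := by
  rw [dt_Q_eq_derivative, if_pos (by omega)]
  congr 2
  omega

theorem wt_cast {N : ℕ} (α : Fin N) {A : Type*} [CommRing A] : (wt α : A) = N + 1 - α := by
  rw [wt, Nat.cast_sub (by omega)]
  push_cast
  ring

/-- The Euler field on polynomials in `x`. -/
def eulerX (N : ℕ) : Derivation ℂ (Polynomial (Poly N)) (Polynomial (Poly N)) :=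
  coeffDer (euler N) +
    (Polynomial.X : Polynomial (Poly N)) • (Polynomial.derivative' (R := Poly N)).restrictScalars ℂ

theorem eulerX_apply (N : ℕ) (p : Polynomial (Poly N)) :
    eulerX N p = coeffDer (euler N) p + Polynomial.X * Polynomial.derivative p := by
  simp [eulerX]

theorem coeffDer_euler (N : ℕ) (p : Polynomial (Poly N)) : coeffDer (euler N) p =
    ∑ α : Fin N, Polynomial.C ((wt α : Poly N) * MvPolynomial.X α) * dt α p := by
  ext1 n
  rw [coeff_coeffDer, euler_apply, Polynomial.finsetSum_coeff]
  simp only [Polynomial.coeff_C_mul, coeff_coeffDer]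

theorem eulerX_C (N : ℕ) (p : Poly N) : eulerX N (Polynomial.C p) = Polynomial.C (euler N p) := by
  simp [eulerX_apply]

/-- With x of weight 1, the entry g of `sig` has weight g + 1, as `euler_recSeq` requires. -/
theorem eulerX_Q (N n : ℕ) : eulerX N (Q N n) = n * Q N n := by
  refine euler_recSeq (eulerX N) (sig N) (fun i => ?_) n
  unfold sig
  split_ifs with h
  · simp [eulerX_apply, h]
  · rw [eulerX_C]
    unfold sv
    split_ifs with h1
    · rw [euler_X, wt_cast]
      have : ((N - i : ℕ) : Poly N) = N - i := Nat.cast_sub h1.2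
      simp [this, add_comm]
    · simp

theorem coeff_Q (N n m : ℕ) (h : n ≤ m + 1) : (Q N n).coeff m = if m = n then 1 else 0 := by
  induction n using Nat.strong_induction_on generalizing m with
  | _ n ih =>
    cases n with
    | zero => rw [Q_zero, Polynomial.coeff_one]
    | succ n =>
      rw [Q_succ, Polynomial.coeff_add, Polynomial.finsetSum_coeff, Finset.sum_eq_zero, add_zero]
      · cases m with
        | zero => simp
        | succ m =>
          rw [Polynomial.coeff_X_mul, ih n (by omega) m (by omega)]
          simp
      · intro g hg
        rw [mem_range] at hg
        rw [Polynomial.coeff_C_mul, ih _ (by omega) m (by omega), if_neg (by omega), mul_zero]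

theorem degree_Q_lt {N n k : ℕ} (h : n < k) : (Q N n).degree < k := by
  rw [Polynomial.degree_lt_iff_coeff_zero]
  intro m hm
  rw [coeff_Q N n m (by omega), if_neg (by omega)]

theorem natDegree_Q (N n : ℕ) : (Q N n).natDegree = n := by
  refine Polynomial.natDegree_eq_of_le_of_coeff_ne_zero ?_ ?_
  · rw [Polynomial.natDegree_le_iff_coeff_eq_zero]
    intro m hm
    rw [coeff_Q N n m (by omega), if_neg (by omega)]
  · rw [coeff_Q N n n (by omega), if_pos rfl]
    exact one_ne_zero

theorem monic_Q (N n : ℕ) : (Q N n).Monic := by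
  rw [Polynomial.Monic, Polynomial.leadingCoeff, natDegree_Q, coeff_Q N n n (by omega), if_pos rfl]

theorem degree_Q (N n : ℕ) : (Q N n).degree = n := by
  rw [Polynomial.degree_eq_natDegree (monic_Q N n).ne_zero, natDegree_Q]

theorem degree_Q_mul_Q (N a b : ℕ) : (Q N a * Q N b).degree = (a + b : ℕ) := by
  rw [(monic_Q N b).degree_mul, degree_Q, degree_Q]
  rfl

/-! ### Products of the Q_n modulo Q_N, and the residue pairing -/

theorem Q_succ_extend (N n : ℕ) (hn : n ≤ N) : Q N (n + 1) = Polynomial.X * Q N n +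
    ∑ g ∈ range N, Polynomial.C (sv N (g + 1)) * (if g < n then Q N (n - (g + 1)) else 0) := by
  rw [Q_succ]
  congr 1
  rw [← Finset.sum_subset (Finset.range_mono hn)]
  · refine Finset.sum_congr rfl fun g hg => ?_
    rw [if_pos (mem_range.1 hg)]
  · intro g _ hg
    rw [if_neg (by simpa using hg), mul_zero]

/-- The two terms x Q_a Q_b cancel, so only the sums of the recursion survive. -/
theorem Q_mul_Q_sub_adjacent (N a b : ℕ) (ha : a ≤ N) (hb : b ≤ N) :
    Q N a * Q N (b + 1) - Q N (a + 1) * Q N b = ∑ g ∈ range N, Polynomial.C (sv N (g + 1)) *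
      ((if g < b then Q N a * Q N (b - (g + 1)) else 0) -
        (if g < a then Q N (a - (g + 1)) * Q N b else 0)) := by
  rw [Q_succ_extend N a ha, Q_succ_extend N b hb, mul_add, add_mul, Finset.mul_sum, Finset.sum_mul]
  have : ∀ x y z w : Polynomial (Poly N), x = z → x + y - (z + w) = y - w := by
    intro x y z w h
    rw [h]; ring
  rw [this _ _ _ _ (by ring), ← Finset.sum_sub_distrib]
  refine Finset.sum_congr rfl fun g _ => ?_
  split_ifs <;> ring

/-- Moving k units from one index to the other is done one unit at a time. A unit move is a
combination of differences of the same kind with smaller total index, together with isolated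
products of degree below N - 1. -/
theorem Q_mul_Q_sub_mem (N : ℕ) (n : ℕ) : ∀ k a b : ℕ, a + k + b = n → a + k ≤ N → b + k ≤ N →
    Q N a * Q N (b + k) - Q N (a + k) * Q N b ∈ Polynomial.degreeLT (Poly N) (N - 1) := by
  induction n using Nat.strong_induction_on with
  | _ n ih =>
    have step : ∀ a b, a + b + 1 = n → a + 1 ≤ N → b + 1 ≤ N →
        Q N a * Q N (b + 1) - Q N (a + 1) * Q N b ∈ Polynomial.degreeLT (Poly N) (N - 1) := by
      intro a b hn ha hb
      have low : ∀ c d : ℕ, c + d < N - 1 →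
          Q N c * Q N d ∈ Polynomial.degreeLT (Poly N) (N - 1) := by
        intro c d h
        rw [Polynomial.mem_degreeLT, degree_Q_mul_Q]
        exact_mod_cast h
      rw [Q_mul_Q_sub_adjacent N a b (by omega) (by omega)]
      refine Submodule.sum_mem _ fun g hg => ?_
      rw [Polynomial.C_mul']
      refine Submodule.smul_mem _ _ ?_
      by_cases h1 : g < b
      · by_cases h2 : g < a
        · rw [if_pos h1, if_pos h2]
          have e := ih (a + (b - (g + 1))) (by omega) (g + 1) (a - (g + 1)) (b - (g + 1))
            (by omega) (by omega) (by omega)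
          have e1 : a - (g + 1) + (g + 1) = a := by omega
          have e2 : b - (g + 1) + (g + 1) = b := by omega
          rw [e1, e2] at e
          rw [← neg_sub]
          exact Submodule.neg_mem _ e
        -- Here g ≥ a, so the isolated product has degree a + b - g - 1 ≤ b - 1 < N - 1.
        · rw [if_pos h1, if_neg h2, sub_zero]
          exact low _ _ (by omega)
      · by_cases h2 : g < a
        · rw [if_neg h1, if_pos h2, zero_sub]
          exact Submodule.neg_mem _ (low _ _ (by omega))
        · rw [if_neg h1, if_neg h2, sub_zero]
          exact Submodule.zero_mem _
    intro k
    induction k with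
    | zero => intro a b _ _ _; simp
    | succ k ihk =>
      intro a b hn ha hb
      have h1 := step a (b + k) (by omega) (by omega) (by omega)
      have h2 := ihk (a + 1) b (by omega) (by omega) (by omega)
      have h3 := Submodule.add_mem _ h1 h2
      rw [sub_add_sub_cancel] at h3
      have e : a + 1 + k = a + (k + 1) := by ring
      rwa [e] at h3

/-- The quotient of `Q_a Q_b` by `Q_N`. -/
def K (N a b : ℕ) : Polynomial (Poly N) := if N ≤ a + b then Q N (a + b - N) else 0

theorem derivative_K {N : ℕ} (α : Fin N) (a : ℕ) :
    Polynomial.derivative (K N a α) = dt α (Q N a) := by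
  rw [dt_Q_eq_derivative, K]
  split_ifs <;> simp

/-- If a + b ≥ N, exchanging indices compares Q_a Q_b with Q_{a+b-N} Q_N up to degree below N - 1.
Otherwise the product is already reduced and monic of degree a + b. -/
theorem coeff_Q_mul_Q_sub_K {N a b m : ℕ} (ha : a < N) (hb : b < N) (hm : N ≤ m + 1) :
    (Q N a * Q N b - K N a b * Q N N).coeff m = if m + 1 = N ∧ a + b = m then 1 else 0 := by
  unfold K
  split_ifs with h1 h2 h2
  · omega
  · have := Q_mul_Q_sub_mem N (a + b) (N - a) a (a + b - N) (by omega) (by omega) (by omega)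
    have e1 : a + b - N + (N - a) = b := by omega
    have e2 : a + (N - a) = N := by omega
    rw [e1, e2, mul_comm (Q N N), Polynomial.mem_degreeLT,
      Polynomial.degree_lt_iff_coeff_zero] at this
    exact this m (by omega)
  · rw [zero_mul, sub_zero, ← h2.2]
    have := (monic_Q N a).mul (monic_Q N b)
    rw [Polynomial.Monic, Polynomial.leadingCoeff, (monic_Q N a).natDegree_mul (monic_Q N b),
      natDegree_Q, natDegree_Q] at this
    exact this
  · rw [zero_mul, sub_zero]
    refine Polynomial.coeff_eq_zero_of_degree_lt ?_
    rw [degree_Q_mul_Q]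
    have : a + b < m := by omega
    exact_mod_cast this

theorem degree_Q_mul_Q_sub_K {N a b : ℕ} (ha : a < N) (hb : b < N) :
    (Q N a * Q N b - K N a b * Q N N).degree < N := by
  rw [Polynomial.degree_lt_iff_coeff_zero]
  intro m hm
  rw [coeff_Q_mul_Q_sub_K ha hb (by omega), if_neg (by omega)]

/-- The coefficient of `x^{N-1}` in the remainder of the division by `M`. -/
def resid {A : Type*} [CommRing A] (N : ℕ) (M : Polynomial A) : Polynomial A →ₗ[A] A :=
  (Polynomial.lcoeff A (N - 1)).comp (Polynomial.modByMonicHom M)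

theorem resid_apply {A : Type*} [CommRing A] (N : ℕ) (M p : Polynomial A) :
    resid N M p = (p %ₘ M).coeff (N - 1) := rfl

theorem resid_mul_self {A : Type*} [CommRing A] (N : ℕ) {M : Polynomial A} (hM : M.Monic)
    (p : Polynomial A) : resid N M (p * M) = 0 := by
  rw [resid_apply, Polynomial.mul_self_modByMonic hM, Polynomial.coeff_zero]

theorem resid_C_mul {A : Type*} [CommRing A] (N : ℕ) (M p : Polynomial A) (a : A) :
    resid N M (Polynomial.C a * p) = a * resid N M p := by
  rw [Polynomial.C_mul', map_smul, smul_eq_mul]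

theorem Q_mul_Q_modByMonic {N a b : ℕ} (ha : a < N) (hb : b < N) :
    (Q N a * Q N b) /ₘ Q N N = K N a b ∧
      (Q N a * Q N b) %ₘ Q N N = Q N a * Q N b - K N a b * Q N N := by
  refine Polynomial.div_modByMonic_unique _ _ (monic_Q N N) ⟨by ring, ?_⟩
  rw [degree_Q]
  exact degree_Q_mul_Q_sub_K ha hb

theorem resid_Q_mul_Q {N a b : ℕ} (ha : a < N) (hb : b < N) :
    resid N (Q N N) (Q N a * Q N b) = if a + b + 1 = N then 1 else 0 := by
  rw [resid_apply, (Q_mul_Q_modByMonic ha hb).2, coeff_Q_mul_Q_sub_K ha hb (by omega)]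
  congr 1
  simp only [eq_iff_iff]
  omega

/-- The bases Q_n and Q_{N-1-n} are dual for the residue pairing, which therefore reads off
coordinates. -/
theorem resid_sum_mul_Q {N : ℕ} (c : Fin N → Poly N) (n : Fin N) :
    resid N (Q N N) ((∑ m : Fin N, Polynomial.C (c m) * Q N m) * Q N n.rev) = c n := by
  rw [Finset.sum_mul, map_sum, Finset.sum_eq_single n]
  · rw [mul_assoc, resid_C_mul, resid_Q_mul_Q n.2 n.rev.2, if_pos (by rw [Fin.val_rev]; omega),
      mul_one]
  · intro m _ hm
    rw [mul_assoc, resid_C_mul, resid_Q_mul_Q m.2 n.rev.2, if_neg, mul_zero]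
    rw [Fin.val_rev]
    intro h
    exact hm (Fin.ext (by omega))
  · simp

theorem exists_eq_sum_Q (N k : ℕ) : ∀ p : Polynomial (Poly N), p.degree < k →
    ∃ c : ℕ → Poly N, p = ∑ n ∈ range k, Polynomial.C (c n) * Q N n := by
  induction k with
  | zero =>
    intro p hp
    refine ⟨0, ?_⟩
    rw [Polynomial.degree_lt_iff_coeff_zero] at hp
    ext1 m
    simpa using hp m (Nat.zero_le _)
  | succ k ih =>
    intro p hp
    obtain ⟨c, hc⟩ := ih (p - Polynomial.C (p.coeff k) * Q N k) (by
      rw [Polynomial.degree_lt_iff_coeff_zero] at hp ⊢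
      intro m hm
      rw [Polynomial.coeff_sub, Polynomial.coeff_C_mul, coeff_Q N k m (by omega)]
      split_ifs with h
      · rw [h]; ring
      · rw [hp m (by omega)]; ring)
    refine ⟨Function.update c k (p.coeff k), ?_⟩
    rw [Finset.sum_range_succ, Function.update_self, ← sub_eq_iff_eq_add, hc]
    refine Finset.sum_congr rfl fun n hn => ?_
    rw [Function.update_of_ne (by rw [mem_range] at hn; omega)]

theorem eq_sum_resid_mul_Q {N : ℕ} (p : Polynomial (Poly N)) (hp : p.degree < N) :
    p = ∑ n : Fin N, Polynomial.C (resid N (Q N N) (p * Q N n.rev)) * Q N n := by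
  obtain ⟨c, hc⟩ := exists_eq_sum_Q N N p hp
  rw [Finset.sum_range] at hc
  conv_lhs => rw [hc]
  refine Finset.sum_congr rfl fun n _ => ?_
  rw [hc, resid_sum_mul_Q (fun n => c n)]

/-! ### Flat coordinates -/

/-- The unfolding, expressed in flat coordinates. -/
def Lam (N : ℕ) : Polynomial (Poly N) :=
  Polynomial.C (MvPolynomial.C (1 / ((N : ℂ) + 1))) * (Polynomial.X * Q N N +
    ∑ α : Fin N, Polynomial.C ((wt α : Poly N) * MvPolynomial.X α) * Q N α)

theorem C_inv_mul_succ (N : ℕ) : (MvPolynomial.C (1 / ((N : ℂ) + 1)) : Poly N) * ((N : Poly N) + 1)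
    = 1 := by
  have hN : (N : ℂ) + 1 ≠ 0 := by exact_mod_cast Nat.succ_ne_zero N
  rw [← map_natCast (MvPolynomial.C (R := ℂ) (σ := Fin N)) N, ← map_one MvPolynomial.C,
    ← map_add, ← map_mul]
  congr 1
  field_simp

theorem CC_inv_mul_succ (N : ℕ) : (Polynomial.C (MvPolynomial.C (1 / ((N : ℂ) + 1))) :
    Polynomial (Poly N)) * ((N : Polynomial (Poly N)) + 1) = 1 := by
  have := congrArg (Polynomial.C (R := Poly N)) (C_inv_mul_succ N)
  simpa only [map_mul, map_add, map_one, map_natCast] using this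

/-- `Lam` is Euler's formula for a function of weight N + 1 with the intended partial derivatives.
Since ∂Q_N/∂t_α = dQ_α/dx, its x-derivative is (Q_N + Euler field applied to Q_N)/(N + 1), and Q_N
has weight N. -/
theorem derivative_Lam (N : ℕ) : Polynomial.derivative (Lam N) = Q N N := by
  have h := eulerX_Q N N
  rw [eulerX_apply, coeffDer_euler] at h
  rw [Lam, Polynomial.derivative_C_mul, Polynomial.derivative_add, Polynomial.derivative_mul,
    Polynomial.derivative_X, Polynomial.derivative_sum]
  simp only [Polynomial.derivative_C_mul, ← dt_Q_top]
  linear_combination (Polynomial.C (MvPolynomial.C (1 / ((N : ℂ) + 1)))) * h +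
    CC_inv_mul_succ N * Q N N

theorem coeffDer_C_mul {R A : Type*} [CommRing R] [CommRing A] [Algebra R A]
    (d : Derivation R A A) (a : A) (p : Polynomial A) :
    coeffDer d (Polynomial.C a * p) =
      Polynomial.C (d a) * p + Polynomial.C a * coeffDer d p := by
  rw [Derivation.leibniz, coeffDer_C, smul_eq_mul, smul_eq_mul, mul_comm p, add_comm]

theorem dt_sum_wt_mul {N : ℕ} (δ : Fin N) (φ : Fin N → Polynomial (Poly N)) :
    dt δ (∑ α : Fin N, Polynomial.C ((wt α : Poly N) * MvPolynomial.X α) * φ α) =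
      (wt δ : Polynomial (Poly N)) * φ δ +
        ∑ α : Fin N, Polynomial.C ((wt α : Poly N) * MvPolynomial.X α) * dt δ (φ α) := by
  rw [map_sum, Finset.sum_congr rfl fun α _ => coeffDer_C_mul _ _ (φ α), Finset.sum_add_distrib]
  congr 1
  rw [Finset.sum_eq_single δ]
  · rw [Derivation.leibniz, Derivation.map_natCast, MvPolynomial.pderiv_X_self, smul_zero, add_zero,
      smul_eq_mul, mul_one, map_natCast]
  · intro b _ hb
    rw [Derivation.leibniz, Derivation.map_natCast, MvPolynomial.pderiv_X_of_ne hb, smul_zero,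
      smul_zero, add_zero, map_zero, zero_mul]
  · simp

/-- The same computation, using the symmetry of ∂Q_α/∂t_δ: the weights of t_{δ+1} and of Q_δ add up
to N + 1. -/
theorem dt_Lam {N : ℕ} (δ : Fin N) : dt δ (Lam N) = Q N δ := by
  have h := eulerX_Q N δ
  rw [eulerX_apply, coeffDer_euler] at h
  have hX : dt δ (Polynomial.X * Q N N) = Polynomial.X * Polynomial.derivative (Q N δ) := by
    rw [Derivation.leibniz, coeffDer_X, smul_zero, add_zero, dt_Q_top, smul_eq_mul]
  rw [Lam, coeffDer_C_mul, MvPolynomial.pderiv_C, map_zero, zero_mul, zero_add, map_add,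
    dt_sum_wt_mul, hX, Finset.sum_congr rfl fun α _ => by rw [dt_Q_symm], wt_cast]
  linear_combination (Polynomial.C (MvPolynomial.C (1 / ((N : ℂ) + 1)))) * h +
    CC_inv_mul_succ N * Q N δ

/-- The unfolding parameters as functions of the flat coordinates. -/
def flatV (N : ℕ) (k : Fin N) : Poly N := (Lam N).coeff k

/-- Read off from the x-derivative Q_N; in particular Λ has no term x^N, as an unfolding must. -/
theorem coeff_Lam_succ (N m : ℕ) (hm : N ≤ m + 1) :
    (Lam N).coeff (m + 1) = if m = N then MvPolynomial.C (1 / ((N : ℂ) + 1)) else 0 := by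
  have h := coeff_Q N N m hm
  rw [← derivative_Lam, Polynomial.coeff_derivative] at h
  have hm0 : (m : Poly N) + 1 ≠ 0 := by exact_mod_cast Nat.succ_ne_zero m
  refine mul_right_cancel₀ hm0 ?_
  rw [h]
  split_ifs with h1
  · rw [h1, C_inv_mul_succ]
  · rw [zero_mul]

theorem unfolding_flatV {N : ℕ} (hN : 0 < N) : unfolding N (flatV N) = Lam N := by
  ext1 m
  rw [unfolding, Polynomial.coeff_add, Polynomial.coeff_C_mul, Polynomial.coeff_X_pow,
    Polynomial.finsetSum_coeff]
  simp only [Polynomial.coeff_C_mul, Polynomial.coeff_X_pow]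
  by_cases hm : m < N
  · rw [if_neg (by omega), mul_zero, zero_add, Finset.sum_eq_single ⟨m, hm⟩]
    · simp [flatV]
    · intro b _ hb
      rw [if_neg, mul_zero]
      rintro rfl
      exact hb rfl
    · simp
  · obtain ⟨k, rfl⟩ : ∃ k, m = k + 1 := ⟨m - 1, by omega⟩
    rw [coeff_Lam_succ N k (by omega), Finset.sum_eq_zero, add_zero]
    · simp
    · intro b _
      have := b.2
      rw [if_neg (by omega), mul_zero]

theorem unfoldingDeriv_flatV {N : ℕ} (hN : 0 < N) : unfoldingDeriv N (flatV N) = Q N N := by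
  rw [unfoldingDeriv, unfolding_flatV hN, derivative_Lam]

theorem coeff_tangent {N : ℕ} (v : Fin N → Poly N) (α k : Fin N) :
    (tangent N v α).coeff k = MvPolynomial.pderiv α (v k) := by
  rw [tangent, Polynomial.finsetSum_coeff, Finset.sum_eq_single k]
  · simp
  · intro b _ hb
    rw [Polynomial.coeff_C_mul, Polynomial.coeff_X_pow, if_neg, mul_zero]
    intro h
    exact hb (Fin.ext h.symm)
  · simp

theorem degree_tangent_lt {N : ℕ} (v : Fin N → Poly N) (α : Fin N) :
    (tangent N v α).degree < N := by
  rw [Polynomial.degree_lt_iff_coeff_zero]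
  intro m hm
  rw [tangent, Polynomial.finsetSum_coeff, Finset.sum_eq_zero]
  intro b _
  have := b.2
  rw [Polynomial.coeff_C_mul, Polynomial.coeff_X_pow, if_neg (by omega), mul_zero]

theorem eq_of_degree_lt_of_coeff_fin {N : ℕ} {A : Type*} [CommRing A] {p q : Polynomial A}
    (hp : p.degree < N) (hq : q.degree < N) (h : ∀ k : Fin N, p.coeff k = q.coeff k) : p = q := by
  rw [Polynomial.degree_lt_iff_coeff_zero] at hp hq
  ext1 m
  by_cases hm : m < N
  · exact h ⟨m, hm⟩
  · rw [hp m (by omega), hq m (by omega)]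

theorem tangent_flatV {N : ℕ} (α : Fin N) : tangent N (flatV N) α = Q N α := by
  refine eq_of_degree_lt_of_coeff_fin (degree_tangent_lt _ _) (degree_Q_lt α.2) fun k => ?_
  rw [coeff_tangent, flatV, ← coeff_coeffDer, dt_Lam]

theorem map_constantCoeff_Q (N n : ℕ) :
    (Q N n).map (MvPolynomial.constantCoeff (R := ℂ)) = Polynomial.X ^ n := by
  induction n with
  | zero => simp [Q_zero]
  | succ n ih =>
    rw [Q_succ, Polynomial.map_add, Polynomial.map_mul, ih, Polynomial.map_X, Polynomial.map_sum,
      Finset.sum_eq_zero, add_zero, pow_succ']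
    intro g _
    rw [Polynomial.map_mul, Polynomial.map_C]
    have : MvPolynomial.constantCoeff (sv N (g + 1)) = 0 := by
      unfold sv
      split_ifs <;> simp
    rw [this, map_zero, zero_mul]

theorem isFlat_flatV {N : ℕ} (hN : 0 < N) : IsFlat N (flatV N) where
  constantCoeff_eq k := by
    have : (Lam N).map (MvPolynomial.constantCoeff (R := ℂ)) =
        Polynomial.C (1 / ((N : ℂ) + 1)) * Polynomial.X ^ (N + 1) := by
      rw [Lam, Polynomial.map_mul, Polynomial.map_add, Polynomial.map_mul, Polynomial.map_sum,
        map_constantCoeff_Q, Finset.sum_eq_zero, add_zero, Polynomial.map_C,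
        MvPolynomial.constantCoeff_C, Polynomial.map_X, pow_succ']
      intro α _
      simp [Polynomial.map_mul]
    rw [flatV, ← Polynomial.coeff_map, this, Polynomial.coeff_C_mul, Polynomial.coeff_X_pow,
      if_neg (by omega), mul_zero]
  linear_eq k α := by
    have h : MvPolynomial.constantCoeff (MvPolynomial.pderiv α (flatV N k)) =
        if α = k then 1 else 0 := by
      rw [flatV, ← coeff_coeffDer, dt_Lam, ← Polynomial.coeff_map, map_constantCoeff_Q,
        Polynomial.coeff_X_pow]
      simp [Fin.ext_iff, eq_comm]
    rw [← h, MvPolynomial.constantCoeff_eq, MvPolynomial.coeff_pderiv]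
    simp
  eta_eq α β := by
    rw [eta, circ, tangent_flatV, tangent_flatV, unfoldingDeriv_flatV hN, ← resid_apply,
      resid_Q_mul_Q α.2 β.2]
    congr 1
    simp only [eq_iff_iff, Fin.ext_iff, Fin.val_rev]
    omega

/-! ### Structure constants and the potential -/

/-- The structure constants `c_{abc} = η(∂_a ∘ ∂_b, ∂_c)`. -/
def sc {N : ℕ} (a b c : Fin N) : Poly N := resid N (Q N N) (Q N a * Q N b * Q N c)

theorem sc_swap {N : ℕ} (a b c : Fin N) : sc a b c = sc b a c := by
  rw [sc, sc, mul_comm (Q N a)]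

theorem sc_swap_right {N : ℕ} (a b c : Fin N) : sc a b c = sc a c b := by
  rw [sc, sc, mul_right_comm]

theorem Q_mul_Q_sub_eq_sum {N : ℕ} (a b : Fin N) : Q N a * Q N b - K N a b * Q N N =
    ∑ n : Fin N, Polynomial.C (sc a b n.rev) * Q N n := by
  rw [eq_sum_resid_mul_Q _ (degree_Q_mul_Q_sub_K a.2 b.2)]
  refine Finset.sum_congr rfl fun n _ => ?_
  rw [sub_mul, map_sub, mul_right_comm (K N a b), resid_mul_self N (monic_Q N N), sub_zero, sc]

theorem Q_mul_Q_eq_sum {N : ℕ} (a b : Fin N) : Q N a * Q N b =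
    ∑ n : Fin N, Polynomial.C (sc a b n.rev) * Q N n + K N a b * Q N N := by
  rw [← Q_mul_Q_sub_eq_sum]
  ring

/-- Reduce Q_a Q_b first, then multiply by Q_d and reduce again. The left side is symmetric in b and
d while the right side is not visibly so; the closedness of the structure constants comes from this.
-/
theorem quotient_assoc {N : ℕ} (a b d : Fin N) : (Q N a * Q N b * Q N d) /ₘ Q N N =
    ∑ n : Fin N, Polynomial.C (sc a b n.rev) * K N n d + K N a b * Q N d := by
  refine (Polynomial.div_modByMonic_unique _
    (∑ n : Fin N, Polynomial.C (sc a b n.rev) * (Q N n * Q N d - K N n d * Q N N))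
    (monic_Q N N) ⟨?_, ?_⟩).1
  · have h : ∑ n : Fin N, Polynomial.C (sc a b n.rev) * (Q N n * Q N d - K N n d * Q N N) =
        (∑ n : Fin N, Polynomial.C (sc a b n.rev) * Q N n) * Q N d -
          (∑ n : Fin N, Polynomial.C (sc a b n.rev) * K N n d) * Q N N := by
      rw [Finset.sum_mul, Finset.sum_mul, ← Finset.sum_sub_distrib]
      refine Finset.sum_congr rfl fun n _ => ?_
      rw [mul_sub, mul_assoc, mul_assoc]
    rw [h]
    linear_combination -Q_mul_Q_eq_sum a b * Q N d
  · rw [degree_Q]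
    refine Polynomial.mem_degreeLT.1 (Submodule.sum_mem _ fun n _ => ?_)
    rw [Polynomial.C_mul']
    exact Submodule.smul_mem _ _ (Polynomial.mem_degreeLT.2 (degree_Q_mul_Q_sub_K n.2 d.2))

theorem derivative_quotient_assoc {N : ℕ} (a b d : Fin N) :
    Polynomial.derivative ((Q N a * Q N b * Q N d) /ₘ Q N N) =
    ∑ n : Fin N, Polynomial.C (sc a b n.rev) * dt d (Q N n) + dt b (Q N a) * Q N d +
      K N a b * Polynomial.derivative (Q N d) := by
  rw [quotient_assoc, Polynomial.derivative_add, Polynomial.derivative_sum,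
    Polynomial.derivative_mul, derivative_K, ← add_assoc]
  simp only [Polynomial.derivative_C_mul, derivative_K]

theorem dt_Q_mul_Q {N : ℕ} (a b d : Fin N) : dt d (Q N a) * Q N b + Q N a * dt d (Q N b) =
    ∑ n : Fin N, Polynomial.C (MvPolynomial.pderiv d (sc a b n.rev)) * Q N n +
      ∑ n : Fin N, Polynomial.C (sc a b n.rev) * dt d (Q N n) + dt d (K N a b) * Q N N +
      K N a b * Polynomial.derivative (Q N d) := by
  have h := congrArg (dt d) (Q_mul_Q_eq_sum a b)
  rw [Derivation.leibniz, map_add, map_sum, Derivation.leibniz, dt_Q_top,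
    Finset.sum_congr rfl fun (n : Fin N) _ =>
      coeffDer_C_mul (MvPolynomial.pderiv d) (sc a b n.rev) (Q N n),
    Finset.sum_add_distrib] at h
  simp only [smul_eq_mul] at h
  linear_combination h

/-- Differentiate the expansion of Q_a Q_b along t_d, and that of Q_a Q_d along t_b. Modulo Q_N the
unwanted terms of both agree, because the x-derivative of the quotient of Q_a Q_b Q_d by Q_N is
symmetric in b and d. Pairing with Q_c isolates the coefficient. -/
theorem pderiv_sc {N : ℕ} (a b d c : Fin N) :
    MvPolynomial.pderiv d (sc a b c) = MvPolynomial.pderiv b (sc a d c) := by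
  have h1 := dt_Q_mul_Q a b d
  have h2 := dt_Q_mul_Q a d b
  have h3 := derivative_quotient_assoc a b d
  rw [mul_right_comm, derivative_quotient_assoc a d b] at h3
  have h4 : ∑ n : Fin N, Polynomial.C (MvPolynomial.pderiv d (sc a b n.rev)) * Q N n -
      ∑ n : Fin N, Polynomial.C (MvPolynomial.pderiv b (sc a d n.rev)) * Q N n =
      (dt b (K N a d) - dt d (K N a b)) * Q N N := by
    rw [dt_Q_symm d b] at h1
    linear_combination h2 - h1 + h3
  have h5 := congrArg (fun p => resid N (Q N N) (p * Q N c)) h4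
  simp only [sub_mul, map_sub] at h5
  rw [← Fin.rev_rev c, resid_sum_mul_Q (fun n => MvPolynomial.pderiv d (sc a b n.rev)),
    resid_sum_mul_Q (fun n => MvPolynomial.pderiv b (sc a d n.rev)), mul_right_comm,
    resid_mul_self N (monic_Q N N), mul_right_comm,
    resid_mul_self N (monic_Q N N), sub_zero, sub_eq_zero] at h5
  simpa using h5

/-- Q_a Q_b has weight a + b, and c_{abc} is the coefficient of Q_{N-1-c} in its reduction;
multiples of Q_N stay multiples of Q_N under the Euler field. -/
theorem euler_sc {N : ℕ} (a b c : Fin N) : euler N (sc a b c) =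
    MvPolynomial.C ((a : ℂ) + b + c + 1 - N) * sc a b c := by
  have h := congrArg (eulerX N) (Q_mul_Q_eq_sum a b)
  rw [Derivation.leibniz, eulerX_Q, eulerX_Q, map_add, map_sum, Derivation.leibniz, eulerX_Q] at h
  have hs : ∀ n : Fin N, eulerX N (Polynomial.C (sc a b n.rev) * Q N n) =
      Polynomial.C (euler N (sc a b n.rev) + (n : Poly N) * sc a b n.rev) * Q N n := by
    intro n
    rw [Derivation.leibniz, eulerX_Q, eulerX_C, map_add, map_mul, map_natCast]
    simp only [smul_eq_mul]
    ring
  rw [Finset.sum_congr rfl fun n _ => hs n] at h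
  simp only [smul_eq_mul] at h
  have h2 : ∑ n : Fin N, Polynomial.C (euler N (sc a b n.rev) + (n : Poly N) * sc a b n.rev) * Q N n
      = Polynomial.C ((a : Poly N) + b) * (Q N a * Q N b) -
        (K N a b * N + eulerX N (K N a b)) * Q N N := by
    rw [map_add, map_natCast, map_natCast]
    linear_combination -h
  have h3 := congrArg (fun p => resid N (Q N N) (p * Q N c)) h2
  simp only [sub_mul, map_sub] at h3
  rw [mul_right_comm _ (Q N N), resid_mul_self N (monic_Q N N), mul_assoc, resid_C_mul,
    sub_zero] at h3
  change _ = _ * sc a b c at h3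
  have h4 := resid_sum_mul_Q
    (fun n : Fin N => euler N (sc a b n.rev) + (n : Poly N) * sc a b n.rev) c.rev
  simp only [Fin.rev_rev] at h4
  rw [h4, Fin.val_rev, Nat.cast_sub (by omega)] at h3
  simp only [map_add, map_sub, map_natCast, map_one]
  push_cast at h3
  linear_combination h3

/-- The primitive of a closed form which is homogeneous with respect to the Euler field. -/
def eulerPrim {N : ℕ} (k : ℂ) (g : Fin N → Poly N) : Poly N :=
  MvPolynomial.C (1 / k) * ∑ c : Fin N, (wt c : Poly N) * MvPolynomial.X c * g c

theorem pderiv_sum_wt_mul {N : ℕ} (e : Fin N) (g : Fin N → Poly N) :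
    MvPolynomial.pderiv e (∑ c : Fin N, (wt c : Poly N) * MvPolynomial.X c * g c) =
      (wt e : Poly N) * g e +
        ∑ c : Fin N, (wt c : Poly N) * MvPolynomial.X c * MvPolynomial.pderiv e (g c) := by
  have h := dt_sum_wt_mul e (fun c => Polynomial.C (g c))
  simp only [← map_mul, ← map_sum, ← map_natCast (Polynomial.C (R := Poly N)), coeffDer_C,
    ← map_add] at h
  exact Polynomial.C_injective h

/-- Poincaré lemma by contraction with the Euler field: closedness turns the sum of derivatives into
the Euler field applied to g_e, and the weights of g_e and t_e add up to k. -/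
theorem pderiv_eulerPrim {N : ℕ} {k : ℂ} (hk : k ≠ 0) {g : Fin N → Poly N} {w : Fin N → ℂ}
    (hg : ∀ c e, MvPolynomial.pderiv e (g c) = MvPolynomial.pderiv c (g e))
    (he : ∀ c, euler N (g c) = MvPolynomial.C (w c) * g c)
    (hw : ∀ c : Fin N, w c + (N + 1 - c) = k) (e : Fin N) :
    MvPolynomial.pderiv e (eulerPrim k g) = g e := by
  have h1 : ∑ c : Fin N, (wt c : Poly N) * MvPolynomial.X c * MvPolynomial.pderiv e (g c) =
      MvPolynomial.C (w e) * g e := by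
    rw [← he e, euler_apply]
    exact Finset.sum_congr rfl fun c _ => by rw [hg]
  have h2 : (wt e : Poly N) = MvPolynomial.C ((N : ℂ) + 1 - e) := by
    rw [wt_cast]; simp
  rw [eulerPrim, MvPolynomial.pderiv_C_mul, pderiv_sum_wt_mul, h1, h2, ← add_mul, ← map_add,
    ← mul_assoc, ← map_mul, add_comm, hw, one_div_mul_cancel hk, map_one, one_mul]

theorem euler_eulerPrim {N : ℕ} {k : ℂ} (hk : k ≠ 0) {g : Fin N → Poly N}
    (h : ∀ e, MvPolynomial.pderiv e (eulerPrim k g) = g e) :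
    euler N (eulerPrim k g) = MvPolynomial.C k * eulerPrim k g := by
  rw [euler_apply, eulerPrim, ← mul_assoc, ← map_mul, mul_one_div_cancel hk, map_one, one_mul]
  refine Finset.sum_congr rfl fun e _ => ?_
  rw [← eulerPrim, h]

theorem eulerEquation_iff {N : ℕ} (F : Poly N) :
    (∑ α : Fin N, MvPolynomial.C (((N : ℂ) + 1 - (α : ℕ)) / ((N : ℂ) + 1)) *
      (MvPolynomial.X α * MvPolynomial.pderiv α F) =
    MvPolynomial.C (3 - ((N : ℂ) - 1) / ((N : ℂ) + 1)) * F) ↔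
    euler N F = MvPolynomial.C (2 * (N : ℂ) + 4) * F := by
  have hN : (N : ℂ) + 1 ≠ 0 := by exact_mod_cast Nat.succ_ne_zero N
  have h1 : ∑ α : Fin N, MvPolynomial.C (((N : ℂ) + 1 - (α : ℕ)) / ((N : ℂ) + 1)) *
      (MvPolynomial.X α * MvPolynomial.pderiv α F) =
      MvPolynomial.C (1 / ((N : ℂ) + 1)) * euler N F := by
    rw [euler_apply, Finset.mul_sum]
    refine Finset.sum_congr rfl fun α _ => ?_
    have h2 : (wt α : Poly N) = MvPolynomial.C ((N : ℂ) + 1 - α) := by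
      rw [wt_cast]; simp
    rw [h2, div_eq_mul_one_div, map_mul]
    ring
  have h3 : (3 - ((N : ℂ) - 1) / ((N : ℂ) + 1)) = (1 / ((N : ℂ) + 1)) * (2 * (N : ℂ) + 4) := by
    field_simp
    ring
  rw [h1, h3, map_mul, mul_assoc]
  refine mul_right_inj' ?_
  rw [Ne, MvPolynomial.C_eq_zero]
  exact one_div_ne_zero hN

theorem circ_flatV {N : ℕ} (α β : Fin N) :
    circ N (flatV N) (tangent N (flatV N) α) (tangent N (flatV N) β) =
      ∑ γ : Fin N, Polynomial.C (sc α β γ) * tangent N (flatV N) γ.rev := by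
  rw [circ, tangent_flatV, tangent_flatV, unfoldingDeriv_flatV (Fin.pos α),
    (Q_mul_Q_modByMonic α.2 β.2).2, Q_mul_Q_sub_eq_sum, ← Equiv.sum_comp Fin.revPerm]
  refine Finset.sum_congr rfl fun γ _ => ?_
  rw [tangent_flatV, Fin.revPerm_apply, Fin.rev_rev]

theorem natCast_add_two_ne_zero (n : ℕ) : (n : ℂ) + 2 ≠ 0 := by
  exact_mod_cast (Nat.succ_ne_zero (n + 1))

/-- Three integrations, at weights a + b + 2, N + 3 + a and 2N + 4. All are nonzero, and closedness
at each stage comes from `pderiv_sc` or from symmetry of what was already built. -/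
theorem exists_primitive (N : ℕ) : ∃ F : Poly N,
    (∀ α β γ, MvPolynomial.pderiv α (MvPolynomial.pderiv β (MvPolynomial.pderiv γ F)) =
      sc α β γ) ∧ euler N F = MvPolynomial.C (2 * (N : ℂ) + 4) * F := by
  have k2 : ∀ a b : Fin N, (a : ℂ) + b + 2 ≠ 0 := fun a b => by
    have := natCast_add_two_ne_zero (a + b)
    push_cast at this
    exact this
  have k1 : ∀ a : Fin N, (N : ℂ) + 3 + a ≠ 0 := fun a => by
    have := natCast_add_two_ne_zero (N + 1 + a)
    push_cast at this
    convert this using 1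
    ring
  have k0 : 2 * (N : ℂ) + 4 ≠ 0 := by
    have := natCast_add_two_ne_zero (2 * N + 2)
    push_cast at this
    convert this using 1
    ring
  obtain ⟨F2, hF2⟩ : ∃ F2 : Fin N → Fin N → Poly N,
      F2 = fun (a b : Fin N) => eulerPrim (((a : ℕ) : ℂ) + (b : ℕ) + 2) (sc a b) := ⟨_, rfl⟩
  have d2 : ∀ a b c, MvPolynomial.pderiv c (F2 a b) = sc a b c := fun a b c => by
    rw [hF2]
    refine pderiv_eulerPrim (w := fun c => (a : ℂ) + b + c + 1 - N) (k2 a b) (fun c e => ?_)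
      (fun c => euler_sc a b c) (fun c => by ring) c
    rw [sc_swap_right a b c, pderiv_sc, sc_swap_right]
  have e2 : ∀ a b, euler N (F2 a b) = MvPolynomial.C ((a : ℂ) + b + 2) * F2 a b := fun a b => by
    have := d2 a b
    rw [hF2] at this ⊢
    exact euler_eulerPrim (k2 a b) this
  have s2 : ∀ a b, F2 a b = F2 b a := fun a b => by
    rw [hF2]
    simp only
    rw [add_comm (a : ℂ), funext (sc_swap a b)]
  obtain ⟨F1, hF1⟩ : ∃ F1 : Fin N → Poly N,
      F1 = fun (a : Fin N) => eulerPrim ((N : ℂ) + 3 + (a : ℕ)) (F2 a) := ⟨_, rfl⟩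
  have d1 : ∀ a b, MvPolynomial.pderiv b (F1 a) = F2 a b := fun a b => by
    rw [hF1]
    refine pderiv_eulerPrim (w := fun b => (a : ℂ) + b + 2) (k1 a) (fun c e => ?_)
      (fun c => e2 a c) (fun c => by ring) b
    rw [d2, d2, sc_swap_right]
  have e1 : ∀ a, euler N (F1 a) = MvPolynomial.C ((N : ℂ) + 3 + a) * F1 a := fun a => by
    have := d1 a
    rw [hF1] at this ⊢
    exact euler_eulerPrim (k1 a) this
  have d0 : ∀ a, MvPolynomial.pderiv a (eulerPrim (2 * (N : ℂ) + 4) F1) = F1 a := fun a => by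
    refine pderiv_eulerPrim (w := fun a => (N : ℂ) + 3 + a) k0 (fun c e => ?_) e1
      (fun c => by ring) a
    rw [d1, d1, s2]
  refine ⟨eulerPrim (2 * (N : ℂ) + 4) F1, fun α β γ => ?_, euler_eulerPrim k0 d0⟩
  -- The integrations return the indices in the order γ, β, α; the structure constants are totally
  -- symmetric.
  rw [d0, d1, d2, sc_swap, sc_swap_right, sc_swap, sc_swap_right, sc_swap_right, sc_swap,
    sc_swap_right]

theorem exists_isPotentialA {N : ℕ} (hN : 0 < N) : ∃ F : Poly N, IsPotentialA N F := by
  obtain ⟨F, hF, hE⟩ := exists_primitive N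
  refine ⟨F, ⟨flatV N, isFlat_flatV hN, fun α β => ?_⟩, (eulerEquation_iff F).2 hE⟩
  rw [circ_flatV]
  exact Finset.sum_congr rfl fun γ _ => by rw [hF]

/-! ### A potential is determined by its third derivatives and its weight -/

theorem euler_pderiv {N : ℕ} (a : Fin N) (p : Poly N) : euler N (MvPolynomial.pderiv a p) =
    MvPolynomial.pderiv a (euler N p) - (wt a : Poly N) * MvPolynomial.pderiv a p := by
  rw [euler_apply, euler_apply, pderiv_sum_wt_mul,
    Finset.sum_congr rfl fun c _ => by rw [pderiv_comm]]
  ring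

theorem euler_pderiv_of_eq {N : ℕ} (a : Fin N) {p : Poly N} {k : ℂ}
    (h : euler N p = MvPolynomial.C k * p) : euler N (MvPolynomial.pderiv a p) =
      MvPolynomial.C (k - (N + 1 - a)) * MvPolynomial.pderiv a p := by
  rw [euler_pderiv, h, MvPolynomial.pderiv_C_mul, wt_cast]
  simp only [map_sub, map_add, map_natCast, map_one]
  ring

theorem eq_zero_of_euler {N : ℕ} {p : Poly N} {k : ℂ} (hk : k ≠ 0)
    (h : euler N p = MvPolynomial.C k * p) (hp : ∀ a, MvPolynomial.pderiv a p = 0) : p = 0 := by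
  rw [euler_apply, Finset.sum_eq_zero fun a _ => by rw [hp, mul_zero]] at h
  rcases mul_eq_zero.1 h.symm with h | h
  · exact absurd (MvPolynomial.C_eq_zero.1 h) hk
  · exact h

/-- Third derivatives miss polynomials of degree at most two; the nonzero weights of D and of its
first and second derivatives exclude those. -/
theorem eq_zero_of_third_derivatives {N : ℕ} {D : Poly N}
    (hE : euler N D = MvPolynomial.C (2 * (N : ℂ) + 4) * D)
    (hD : ∀ α β γ, MvPolynomial.pderiv α (MvPolynomial.pderiv β (MvPolynomial.pderiv γ D)) = 0) :
    D = 0 := by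
  refine eq_zero_of_euler ?_ hE fun a =>
    eq_zero_of_euler ?_ (euler_pderiv_of_eq a hE) fun b =>
      eq_zero_of_euler ?_ (euler_pderiv_of_eq b (euler_pderiv_of_eq a hE)) fun c => hD c b a
  · have := natCast_add_two_ne_zero (2 * N + 2)
    push_cast at this
    convert this using 1
    ring
  · have := natCast_add_two_ne_zero (N + 1 + a)
    push_cast at this
    convert this using 1
    ring
  · have := natCast_add_two_ne_zero (a + b)
    push_cast at this
    convert this using 1
    ring

/-! ### Uniqueness of the flat coordinates and of the potential -/

/-- Differentiate p = r + M·(p /ₘ M): the derivative of r still has degree below that of M, so it is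
the remainder of what is left. -/
theorem coeffDer_modByMonic {R A : Type*} [CommRing R] [CommRing A] [Nontrivial A] [Algebra R A]
    (d : Derivation R A A) {M : Polynomial A} (hM : M.Monic) (p : Polynomial A) :
    coeffDer d (p %ₘ M) = (coeffDer d p - (p /ₘ M) * coeffDer d M) %ₘ M := by
  have h := congrArg (coeffDer d) (Polynomial.modByMonic_add_div p M)
  rw [map_add, Derivation.leibniz, smul_eq_mul, smul_eq_mul] at h
  refine ((Polynomial.div_modByMonic_unique (coeffDer d (p /ₘ M)) _ hM ⟨?_, ?_⟩).2).symm
  · linear_combination h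
  · have h2 := Polynomial.degree_modByMonic_lt p hM
    rw [Polynomial.degree_eq_natDegree hM.ne_zero] at h2 ⊢
    exact degree_coeffDer_lt d h2

theorem derivation_resid {R A : Type*} [CommRing R] [CommRing A] [Nontrivial A] [Algebra R A]
    (N : ℕ) (d : Derivation R A A) {M : Polynomial A} (hM : M.Monic) (p : Polynomial A) :
    d (resid N M p) = resid N M (coeffDer d p) - resid N M ((p /ₘ M) * coeffDer d M) := by
  rw [resid_apply, ← coeff_coeffDer, coeffDer_modByMonic d hM, ← map_sub, resid_apply]

theorem map_resid {A B : Type*} [CommRing A] [CommRing B] (N : ℕ) (f : A →+* B)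
    {M : Polynomial A} (hM : M.Monic) (p : Polynomial A) :
    f (resid N M p) = resid N (M.map f) (p.map f) := by
  rw [resid_apply, resid_apply, ← Polynomial.map_modByMonic f hM, Polynomial.coeff_map]

theorem dt_unfolding {N : ℕ} (v : Fin N → Poly N) (γ : Fin N) :
    dt γ (unfolding N v) = tangent N v γ := by
  have hX : ∀ n : ℕ, dt γ (Polynomial.X ^ n) = 0 := fun n => by
    rw [Derivation.leibniz_pow, coeffDer_X, smul_zero, smul_zero]
  rw [unfolding, tangent, map_add, coeffDer_C_mul, hX, map_sum, MvPolynomial.pderiv_C, map_zero,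
    zero_mul, mul_zero, zero_add, zero_add]
  refine Finset.sum_congr rfl fun k _ => ?_
  rw [coeffDer_C_mul, hX, mul_zero, add_zero]

theorem dt_unfoldingDeriv {N : ℕ} (v : Fin N → Poly N) (γ : Fin N) :
    dt γ (unfoldingDeriv N v) = Polynomial.derivative (tangent N v γ) := by
  rw [unfoldingDeriv, coeffDer_derivative, dt_unfolding]

theorem dt_tangent_comm {N : ℕ} (v : Fin N → Poly N) (α γ : Fin N) :
    dt γ (tangent N v α) = dt α (tangent N v γ) := by
  rw [← dt_unfolding, ← dt_unfolding, dt_comm]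

/-- `η(∇_γ ∂_α, ∂_β)` for the trivial connection. -/
def hess {N : ℕ} (v : Fin N → Poly N) (α γ β : Fin N) : Poly N :=
  resid N (unfoldingDeriv N v) (dt γ (tangent N v α) * tangent N v β)

/-- The derivative of the residue pairing along `∂_γ` with the arguments `∂_α` and `∂_β` kept
constant, up to sign. -/
def pairDeriv {N : ℕ} (v : Fin N → Poly N) (α β γ : Fin N) : Poly N :=
  resid N (unfoldingDeriv N v) ((tangent N v α * tangent N v β) /ₘ unfoldingDeriv N v *
    Polynomial.derivative (tangent N v γ))

/-- Compatibility with the metric: η is constant in flat coordinates, so the derivatives of its two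
arguments cancel the derivative of the residue functional. -/
theorem hess_add_hess {N : ℕ} {v : Fin N → Poly N} (hv : IsFlat N v) (α β γ : Fin N) :
    hess v α γ β + hess v β γ α = pairDeriv v α β γ := by
  have h1 : MvPolynomial.pderiv γ (resid N (unfoldingDeriv N v)
      (tangent N v α * tangent N v β)) = 0 := by
    have := hv.eta_eq α β
    rw [eta, circ, ← resid_apply] at this
    rw [this]
    split_ifs <;> simp
  rw [derivation_resid N _ (unfoldingDeriv_monic N v).1, dt_unfoldingDeriv, sub_eq_zero,
    Derivation.leibniz, map_add, smul_eq_mul, smul_eq_mul, mul_comm (tangent N v α), add_comm,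
    mul_comm (tangent N v β) (dt γ (tangent N v α))] at h1
  exact h1

/-- Koszul's formula; torsion-freeness is the symmetry of second derivatives of Λ. -/
theorem two_mul_hess {N : ℕ} {v : Fin N → Poly N} (hv : IsFlat N v) (α γ β : Fin N) :
    2 * hess v α γ β = pairDeriv v α β γ + pairDeriv v γ β α - pairDeriv v α γ β := by
  have hs : ∀ a b c, hess v a b c = hess v b a c := fun a b c => by
    rw [hess, hess, dt_tangent_comm]
  rw [← hess_add_hess hv, ← hess_add_hess hv, ← hess_add_hess hv, hs γ α β, hs β α γ, hs β γ α]
  ring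

theorem map_hess {N : ℕ} {B : Type*} [CommRing B] (f : Poly N →+* B) (v : Fin N → Poly N)
    (α γ β : Fin N) : f (hess v α γ β) = resid N ((unfoldingDeriv N v).map f)
      ((dt γ (tangent N v α)).map f * (tangent N v β).map f) := by
  rw [hess, map_resid N f (unfoldingDeriv_monic N v).1, Polynomial.map_mul]

theorem map_pairDeriv {N : ℕ} {B : Type*} [CommRing B] (f : Poly N →+* B) (v : Fin N → Poly N)
    (α β γ : Fin N) : f (pairDeriv v α β γ) = resid N ((unfoldingDeriv N v).map f)
      (((tangent N v α).map f * (tangent N v β).map f) /ₘ (unfoldingDeriv N v).map f *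
        Polynomial.derivative ((tangent N v γ).map f)) := by
  rw [pairDeriv, map_resid N f (unfoldingDeriv_monic N v).1, Polynomial.map_mul,
    Polynomial.map_divByMonic f (unfoldingDeriv_monic N v).1, Polynomial.map_mul,
    Polynomial.derivative_map]

/-- By Koszul's formula the second derivatives of v are expressed through v and its first
derivatives, so congruence of the latter modulo an ideal propagates to the former. -/
theorem hessian_sub_mem {N : ℕ} {v : Fin N → Poly N} (hv : IsFlat N v) (I : Ideal (Poly N))
    (h0 : ∀ k, v k - flatV N k ∈ I)
    (h1 : ∀ α k, MvPolynomial.pderiv α (v k) - MvPolynomial.pderiv α (flatV N k) ∈ I)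
    (α γ k : Fin N) : MvPolynomial.pderiv γ (MvPolynomial.pderiv α (v k)) -
      MvPolynomial.pderiv γ (MvPolynomial.pderiv α (flatV N k)) ∈ I := by
  have hN : 0 < N := Fin.pos k
  have hw := isFlat_flatV hN
  set π := Ideal.Quotient.mk I with hπ
  have hT : ∀ α, (tangent N v α).map π = (tangent N (flatV N) α).map π := fun α => by
    rw [tangent, tangent, Polynomial.map_sum, Polynomial.map_sum]
    refine Finset.sum_congr rfl fun k _ => ?_
    rw [Polynomial.map_mul, Polynomial.map_mul, Polynomial.map_C, Polynomial.map_C,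
      Ideal.Quotient.eq.2 (h1 α k)]
  have hP : (unfoldingDeriv N v).map π = (unfoldingDeriv N (flatV N)).map π := by
    rw [unfoldingDeriv, unfoldingDeriv, ← Polynomial.derivative_map, ← Polynomial.derivative_map,
      unfolding, unfolding, Polynomial.map_add, Polynomial.map_add, Polynomial.map_sum,
      Polynomial.map_sum]
    refine congrArg Polynomial.derivative (congrArg₂ (· + ·) rfl ?_)
    refine Finset.sum_congr rfl fun k _ => ?_
    rw [Polynomial.map_mul, Polynomial.map_mul, Polynomial.map_C, Polynomial.map_C,
      Ideal.Quotient.eq.2 (h0 k)]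
  have hR : ∀ α β γ, π (pairDeriv v α β γ) = π (pairDeriv (flatV N) α β γ) := fun α β γ => by
    rw [map_pairDeriv, map_pairDeriv, hP, hT, hT, hT]
  have hH : ∀ β, π (hess v α γ β) = π (hess (flatV N) α γ β) := fun β => by
    have h : π (2 * hess v α γ β) = π (2 * hess (flatV N) α γ β) := by
      rw [two_mul_hess hv, two_mul_hess hw, map_sub, map_add, map_sub, map_add, hR, hR, hR]
    have h2 : (MvPolynomial.C (1 / 2 : ℂ) : Poly N) * 2 = 1 := by
      rw [← map_ofNat (MvPolynomial.C (R := ℂ) (σ := Fin N)) 2, ← map_mul]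
      norm_num
    have h3 := congrArg (fun x => π (MvPolynomial.C (1 / 2 : ℂ)) * x) h
    simp only [← map_mul, ← mul_assoc, h2, one_mul] at h3
    exact h3
  set Z := dt γ (tangent N v α) - dt γ (tangent N (flatV N) α) with hZ
  have hZdeg : Z.degree < N := by
    refine lt_of_le_of_lt (Polynomial.degree_sub_le _ _) (max_lt ?_ ?_) <;>
      exact degree_coeffDer_lt _ (degree_tangent_lt _ _)
  -- Modulo I both families have the same ∂Λ/∂x and the same tangent vectors, so the two Hessians
  -- are paired with the same dual basis.
  have hZβ : ∀ β : Fin N, resid N (Q N N) (Z * Q N β) ∈ I := fun β => by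
    rw [← Ideal.Quotient.eq_zero_iff_mem, ← hπ, map_resid N π (monic_Q N N), Polynomial.map_mul,
      Polynomial.map_sub, sub_mul, map_sub, ← unfoldingDeriv_flatV hN, ← tangent_flatV β,
      ← map_hess, ← hP, ← hT, ← map_hess, hH, sub_self]
  have hcoeff : Z.coeff k ∈ I := by
    rw [eq_sum_resid_mul_Q Z hZdeg, Polynomial.finsetSum_coeff]
    refine Ideal.sum_mem _ fun n _ => ?_
    rw [Polynomial.coeff_C_mul]
    exact Ideal.mul_mem_right _ _ (hZβ _)
  rwa [hZ, Polynomial.coeff_sub, coeff_coeffDer, coeff_coeffDer, coeff_tangent,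
    coeff_tangent] at hcoeff

open MvPolynomial in
theorem pderiv_mem_pow_idealOfVars {σ : Type*} {p : MvPolynomial σ ℂ} {d : ℕ}
    (h : p ∈ idealOfVars σ ℂ ^ (d + 1)) (i : σ) : pderiv i p ∈ idealOfVars σ ℂ ^ d := by
  rw [mem_pow_idealOfVars_iff'] at h ⊢
  intro x hx
  rw [coeff_pderiv, h, zero_mul]
  rw [map_add, Finsupp.degree_single]
  omega

theorem exists_add_single {σ : Type*} {x : σ →₀ ℕ} (hx : 0 < Finsupp.degree x) :
    ∃ i y, x = y + Finsupp.single i 1 := by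
  have hne : x ≠ 0 := by
    rintro rfl
    simp at hx
  obtain ⟨i, hi⟩ := Finsupp.ne_iff.1 hne
  refine ⟨i, x - Finsupp.single i 1, ?_⟩
  rw [tsub_add_cancel_of_le]
  rw [Finsupp.single_le_iff]
  simp only [Finsupp.coe_zero, Pi.zero_apply] at hi
  omega

open MvPolynomial in
-- In characteristic zero a coefficient of degree at least two is recovered from a second
-- derivative; h covers the degrees 0 and 1.
theorem mem_pow_idealOfVars_of_pderiv {σ : Type*} {p : MvPolynomial σ ℂ} {d : ℕ}
    (h : p ∈ idealOfVars σ ℂ ^ 2)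
    (h2 : ∀ i j, pderiv j (pderiv i p) ∈ idealOfVars σ ℂ ^ d) : p ∈ idealOfVars σ ℂ ^ (d + 2) := by
  simp only [mem_pow_idealOfVars_iff'] at h h2 ⊢
  intro x hx
  by_cases hx2 : Finsupp.degree x < 2
  · exact h x hx2
  obtain ⟨i, y, rfl⟩ := exists_add_single (x := x) (by omega)
  rw [map_add, Finsupp.degree_single] at hx hx2
  obtain ⟨j, z, rfl⟩ := exists_add_single (x := y) (by omega)
  rw [map_add, Finsupp.degree_single] at hx hx2
  have h3 := h2 i j z (by omega)
  rw [coeff_pderiv, coeff_pderiv] at h3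
  have hne : ∀ n : ℕ, (n : ℂ) + 1 ≠ 0 := fun n => by exact_mod_cast Nat.succ_ne_zero n
  rcases mul_eq_zero.1 h3 with h4 | h4
  · rcases mul_eq_zero.1 h4 with h5 | h5
    · exact h5
    · exact absurd h5 (hne _)
  · exact absurd h4 (hne _)

open MvPolynomial in
theorem IsFlat.sub_mem_sq {N : ℕ} {v w : Fin N → Poly N} (hv : IsFlat N v) (hw : IsFlat N w)
    (k : Fin N) : v k - w k ∈ idealOfVars (Fin N) ℂ ^ 2 := by
  rw [mem_pow_idealOfVars_iff']
  intro x hx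
  rw [coeff_sub]
  by_cases h0 : 0 < Finsupp.degree x
  · obtain ⟨i, y, rfl⟩ := exists_add_single h0
    rw [map_add, Finsupp.degree_single] at hx
    have hy : y = 0 := by
      rw [← Finsupp.degree_eq_zero_iff]
      omega
    rw [hy, zero_add, hv.linear_eq, hw.linear_eq, sub_self]
  · have hx0 : x = 0 := by
      rw [← Finsupp.degree_eq_zero_iff]
      omega
    rw [hx0]
    change constantCoeff (v k) - constantCoeff (w k) = 0
    rw [hv.constantCoeff_eq, hw.constantCoeff_eq, sub_zero]

open MvPolynomial in
-- Bootstrapping: agreement to order d + 2 gives agreement of first derivatives to order d + 1,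
-- hence of second derivatives to order d + 1, hence of v to order d + 3.
theorem IsFlat.eq_flatV {N : ℕ} {v : Fin N → Poly N} (hv : IsFlat N v) : v = flatV N := by
  funext k
  have hN : 0 < N := Fin.pos k
  have key : ∀ d : ℕ, ∀ k, v k - flatV N k ∈ idealOfVars (Fin N) ℂ ^ (d + 2) := by
    intro d
    induction d with
    | zero => exact fun k => hv.sub_mem_sq (isFlat_flatV hN) k
    | succ d ih =>
      intro k
      refine mem_pow_idealOfVars_of_pderiv (hv.sub_mem_sq (isFlat_flatV hN) k) fun i j => ?_
      rw [map_sub, map_sub]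
      refine hessian_sub_mem hv _ (fun k => ?_) (fun α k => ?_) i j k
      · exact Ideal.pow_le_pow_right (by omega) (ih k)
      · rw [← map_sub]
        exact pderiv_mem_pow_idealOfVars (ih k) α
  rw [← sub_eq_zero]
  ext x
  exact (mem_pow_idealOfVars_iff' _ _).1 (key (Finsupp.degree x) k) x (by omega)

theorem IsPotentialA.pderiv_eq_sc {N : ℕ} {F : Poly N} (hF : IsPotentialA N F) (α β γ : Fin N) :
    MvPolynomial.pderiv α (MvPolynomial.pderiv β (MvPolynomial.pderiv γ F)) = sc α β γ := by
  obtain ⟨⟨v, hv, h⟩, -⟩ := hF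
  obtain rfl := hv.eq_flatV
  have h1 := h α β
  rw [circ_flatV] at h1
  have h2 : ∀ c : Fin N → Poly N, resid N (Q N N)
      ((∑ n : Fin N, Polynomial.C (c n) * tangent N (flatV N) n.rev) * Q N γ) = c γ := by
    intro c
    rw [← Equiv.sum_comp Fin.revPerm]
    simp only [Fin.revPerm_apply, Fin.rev_rev, tangent_flatV]
    have := resid_sum_mul_Q (fun n => c n.rev) γ.rev
    simpa only [Fin.rev_rev] using this
  rw [← h2 (sc α β), h1, h2]

theorem existsUnique_isPotentialA {N : ℕ} (hN : 0 < N) : ∃! F : Poly N, IsPotentialA N F := by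
  obtain ⟨F, hF⟩ := exists_isPotentialA hN
  refine ⟨F, hF, fun G hG => ?_⟩
  rw [← sub_eq_zero]
  refine eq_zero_of_third_derivatives ?_ fun α β γ => ?_
  · rw [map_sub, (eulerEquation_iff F).1 hF.2, (eulerEquation_iff G).1 hG.2, mul_sub]
  · rw [map_sub, map_sub, map_sub, hF.pderiv_eq_sc, hG.pderiv_eq_sc, sub_self]

theorem isPotentialA_FA {N : ℕ} (hN : 0 < N) : IsPotentialA N (FA N) := by
  have h := existsUnique_isPotentialA hN
  rw [FA, dif_pos h]
  exact h.choose_spec.1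

/-! ### The second derivatives of the potential -/

/-- `∂_a ∂_b F_{A_N}` times its weight. -/
def secondDer {N : ℕ} (a b : Fin N) : Poly N :=
  ∑ c : Fin N, (wt c : Poly N) * MvPolynomial.X c * sc a b c

/-- Euler's identity for ∂_a∂_bF, of weight (2N + 4) - (N + 1 - a) - (N + 1 - b) = a + b + 2. -/
theorem secondDer_eq {N : ℕ} (a b : Fin N) : MvPolynomial.C ((a : ℂ) + b + 2) *
    MvPolynomial.pderiv a (MvPolynomial.pderiv b (FA N)) = secondDer a b := by
  have hF := isPotentialA_FA (Fin.pos a)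
  have h := euler_pderiv_of_eq a (euler_pderiv_of_eq b ((eulerEquation_iff _).1 hF.2))
  have e : 2 * (N : ℂ) + 4 - (N + 1 - b) - (N + 1 - a) = (a : ℂ) + b + 2 := by ring
  rw [e] at h
  rw [← h, euler_apply, secondDer]
  refine Finset.sum_congr rfl fun c _ => ?_
  rw [hF.pderiv_eq_sc, sc_swap, sc_swap_right]

/-! ### A recursion for the second derivatives -/

/-- The recursion satisfied by the second derivatives of the potential, multiplied by their
weights, as functions of the reversed coordinates `s`, in the range `a + b ≤ M`. -/
structure SecondDerRec {B : Type*} [CommRing B] (s : ℕ → B) (e : ℕ → ℕ → B) (M : ℕ) : Prop where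
  zero_left : ∀ n ≤ M, e 0 n = ((n : B) + 2) * s n
  succ_left : ∀ a b, a + b + 1 ≤ M → e (a + 1) b = e a (b + 1) -
    (∑ g ∈ range b, s g * e a (b - (g + 1)) - ∑ g ∈ range a, s g * e (a - (g + 1)) b)

theorem SecondDerRec.map {B B' : Type*} [CommRing B] [CommRing B'] (f : B →+* B') {s : ℕ → B}
    {e : ℕ → ℕ → B} {M : ℕ} (h : SecondDerRec s e M) :
    SecondDerRec (fun g => f (s g)) (fun a b => f (e a b)) M where
  zero_left n hn := by rw [h.zero_left n hn, map_mul, map_add, map_natCast, map_ofNat]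
  succ_left a b hab := by rw [h.succ_left a b hab]; simp

/-- Induction on a + b, then on a: the sums only involve smaller a + b, and the remaining term
lowers a. -/
theorem SecondDerRec.unique {B : Type*} [CommRing B] {s s' : ℕ → B} {e e' : ℕ → ℕ → B} {M : ℕ}
    (h : SecondDerRec s e M) (h' : SecondDerRec s' e' M) (hs : ∀ g ≤ M, s g = s' g) :
    ∀ a b, a + b ≤ M → e a b = e' a b := by
  have key : ∀ m ≤ M, ∀ a b, a + b = m → e a b = e' a b := by
    intro m
    induction m using Nat.strong_induction_on with
    | _ m ih =>
      intro hm a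
      induction a with
      | zero =>
        intro b hb
        rw [h.zero_left b (by omega), h'.zero_left b (by omega), hs b (by omega)]
      | succ a iha =>
        intro b hb
        rw [h.succ_left a b (by omega), h'.succ_left a b (by omega), iha (b + 1) (by omega)]
        congr 2
        · refine Finset.sum_congr rfl fun g hg => ?_
          rw [mem_range] at hg
          rw [hs g (by omega), ih (a + (b - (g + 1))) (by omega) (by omega) _ _ rfl]
        · refine Finset.sum_congr rfl fun g hg => ?_
          rw [mem_range] at hg
          rw [hs g (by omega), ih (a - (g + 1) + b) (by omega) (by omega) _ _ rfl]
  exact fun a b hab => key (a + b) hab a b rfl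

/-- The Euler field, as an element of the Jacobian ring. -/
def eulerField (N : ℕ) : Polynomial (Poly N) :=
  ∑ c : Fin N, Polynomial.C ((wt c : Poly N) * MvPolynomial.X c) * Q N c

theorem secondDer_eq_resid {N : ℕ} (a b : Fin N) :
    secondDer a b = resid N (Q N N) (Q N a * Q N b * eulerField N) := by
  rw [secondDer, eulerField, Finset.mul_sum, map_sum]
  refine Finset.sum_congr rfl fun c _ => ?_
  rw [mul_left_comm, resid_C_mul, sc]

theorem resid_Q_mul_eulerField {N n : ℕ} (hn : n < N) :
    resid N (Q N N) (Q N n * eulerField N) = ((n : Poly N) + 2) * sv N (n + 1) := by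
  rw [eulerField, Finset.mul_sum, map_sum, Finset.sum_eq_single ⟨N - (n + 1), by omega⟩]
  · rw [mul_left_comm, resid_C_mul, resid_Q_mul_Q hn (by simp; omega), if_pos (by simp; omega),
      mul_one, sv, dif_pos (by omega), wt]
    congr 1
    have : N + 1 - (N - (n + 1)) = n + 2 := by omega
    simp only [this]
    push_cast
    ring
  · intro c _ hc
    rw [mul_left_comm, resid_C_mul, resid_Q_mul_Q hn c.2, if_neg, mul_zero]
    intro h
    exact hc (Fin.ext (by simp; omega))
  · simp

/-- Subtracting the recursions for Q_{a+1} Q_b and Q_a Q_{b+1} removes x, and the residue against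
the Euler field is linear. For a = 0 duality selects a single coordinate. -/
theorem secondDerRec_resid (N : ℕ) : SecondDerRec (fun g => sv N (g + 1))
    (fun a b => resid N (Q N N) (Q N a * Q N b * eulerField N)) (N - 1) where
  zero_left n hn := by
    -- For N = 0 the bound N - 1 truncates to 0, so n = 0 is still required; both sides are zero.
    rcases Nat.eq_zero_or_pos N with rfl | hN
    · have : sv 0 (n + 1) = 0 := by
        rw [sv, dif_neg (by omega)]
      simp [this, eulerField]
    · rw [Q_zero, one_mul, resid_Q_mul_eulerField (by omega)]
  succ_left a b _ := by
    have h : Q N (a + 1) * Q N b = Q N a * Q N (b + 1) -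
        (∑ g ∈ range b, Polynomial.C (sv N (g + 1)) * (Q N a * Q N (b - (g + 1))) -
          ∑ g ∈ range a, Polynomial.C (sv N (g + 1)) * (Q N (a - (g + 1)) * Q N b)) := by
      have h1 : ∑ g ∈ range b, Polynomial.C (sv N (g + 1)) * (Q N a * Q N (b - (g + 1))) =
          Q N a * ∑ g ∈ range b, Polynomial.C (sv N (g + 1)) * Q N (b - (g + 1)) := by
        rw [Finset.mul_sum]
        exact Finset.sum_congr rfl fun g _ => by rw [mul_left_comm]
      have h2 : ∑ g ∈ range a, Polynomial.C (sv N (g + 1)) * (Q N (a - (g + 1)) * Q N b) =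
          (∑ g ∈ range a, Polynomial.C (sv N (g + 1)) * Q N (a - (g + 1))) * Q N b := by
        rw [Finset.sum_mul]
        exact Finset.sum_congr rfl fun g _ => by rw [mul_assoc]
      rw [h1, h2]
      linear_combination Q_succ N a * Q N b - Q N a * Q_succ N b
    rw [h, sub_mul, sub_mul, map_sub, map_sub, Finset.sum_mul, Finset.sum_mul, map_sum, map_sum]
    simp only [mul_assoc, resid_C_mul]

/-! ### Taylor expansion over compositions -/

/-- Iterated partial derivatives. -/
def iterPderiv {N : ℕ} (l : List (Fin N)) (P : Poly N) : Poly N :=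
  l.foldr (fun i p => MvPolynomial.pderiv i p) P

theorem iterPderiv_pderiv {N : ℕ} (l : List (Fin N)) (i : Fin N) (P : Poly N) :
    MvPolynomial.pderiv i (iterPderiv l P) = iterPderiv l (MvPolynomial.pderiv i P) := by
  induction l with
  | nil => rfl
  | cons j l ih =>
    change MvPolynomial.pderiv i (MvPolynomial.pderiv j (iterPderiv l P)) = _
    rw [pderiv_comm, ih]
    rfl

theorem iterPderiv_sum {N : ℕ} {ι : Type*} (S : Finset ι) (l : List (Fin N)) (P : ι → Poly N) :
    iterPderiv l (∑ x ∈ S, P x) = ∑ x ∈ S, iterPderiv l (P x) := by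
  induction l with
  | nil => rfl
  | cons j l ih =>
    change MvPolynomial.pderiv j (iterPderiv l _) = ∑ x ∈ S, MvPolynomial.pderiv j (iterPderiv l _)
    rw [ih, map_sum]

theorem coeff_iterPderiv {N : ℕ} (l : List (Fin N)) (P : Poly N) (y : Fin N →₀ ℕ)
    (h : MvPolynomial.coeff (y + (l.map fun i => Finsupp.single i 1).sum) P = 0) :
    MvPolynomial.coeff y (iterPderiv l P) = 0 := by
  induction l generalizing y with
  | nil => simpa [iterPderiv] using h
  | cons j l ih =>
    change MvPolynomial.coeff y (MvPolynomial.pderiv j (iterPderiv l P)) = 0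
    rw [MvPolynomial.coeff_pderiv, ih, zero_mul]
    rw [List.map_cons, List.sum_cons, ← add_assoc] at h
    exact h

section Taylor

variable {T : Type*} [CommRing T] [Algebra ℂ T]

/-- The part of degree `m` of the Taylor expansion, times `m!`. -/
def taylorPart {N : ℕ} (u : Fin N → T) (m : ℕ) (P : Poly N) : T :=
  ∑ f : Fin m → Fin N, MvPolynomial.constantCoeff (iterPderiv (List.ofFn f) P) •
    ((List.ofFn f).map u).prod

theorem taylorPart_succ {N : ℕ} (u : Fin N → T) (m : ℕ) (P : Poly N) :
    taylorPart u (m + 1) P = ∑ i, u i * taylorPart u m (MvPolynomial.pderiv i P) := by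
  rw [taylorPart, ← (Fin.consEquiv fun _ => Fin N).sum_comp, Fintype.sum_prod_type]
  refine Finset.sum_congr rfl fun i _ => ?_
  rw [taylorPart, Finset.mul_sum]
  refine Finset.sum_congr rfl fun f _ => ?_
  simp only [Fin.consEquiv_apply, List.ofFn_succ, Fin.cons_zero, Fin.cons_succ, List.map_cons,
    List.prod_cons]
  rw [← iterPderiv_pderiv, mul_smul_comm]
  rfl

theorem taylorPart_sum {N : ℕ} {ι : Type*} (S : Finset ι) (u : Fin N → T) (m : ℕ)
    (P : ι → Poly N) : taylorPart u m (∑ x ∈ S, P x) = ∑ x ∈ S, taylorPart u m (P x) := by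
  simp only [taylorPart, iterPderiv_sum, map_sum, Finset.sum_smul]
  rw [Finset.sum_comm]

theorem taylorPart_monomial {N : ℕ} (u : Fin N → T) (m : ℕ) (x : Fin N →₀ ℕ) (c : ℂ) :
    taylorPart u m (MvPolynomial.monomial x c) = if Finsupp.degree x = m then
      (m.factorial : ℂ) • MvPolynomial.aeval u (MvPolynomial.monomial x c) else 0 := by
  induction m generalizing x c with
  | zero =>
    have h0 : taylorPart u 0 (MvPolynomial.monomial x c) =
        algebraMap ℂ T (MvPolynomial.constantCoeff (MvPolynomial.monomial x c)) := by
      simp [taylorPart, iterPderiv, Algebra.algebraMap_eq_smul_one]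
    rw [h0, MvPolynomial.constantCoeff_monomial]
    by_cases hx : x = 0
    · subst hx
      simp
    · rw [if_neg hx, if_neg (by rwa [Finsupp.degree_eq_zero_iff]), map_zero]
  | succ m ih =>
    -- Each direction i contributes x_i · m!, and the x_i sum to m + 1, which produces (m + 1)!.
    have h1 : ∀ i, u i * taylorPart u m (MvPolynomial.pderiv i (MvPolynomial.monomial x c)) =
        if Finsupp.degree x = m + 1 then ((x i : ℂ) * (m.factorial : ℂ)) •
          MvPolynomial.aeval u (MvPolynomial.monomial x c) else 0 := by
      intro i
      rw [MvPolynomial.pderiv_monomial, ih]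
      by_cases hi : x i = 0
      · simp [hi]
      · obtain ⟨y, hy⟩ : ∃ y, x = y + Finsupp.single i 1 :=
          ⟨x - Finsupp.single i 1, by
            rw [tsub_add_cancel_of_le]
            rw [Finsupp.single_le_iff]
            omega⟩
        subst hy
        rw [add_tsub_cancel_right, map_add, Finsupp.degree_single]
        simp only [add_left_inj]
        split_ifs
        · have e : (MvPolynomial.monomial (y + Finsupp.single i 1) c : Poly N) =
              MvPolynomial.monomial y c * MvPolynomial.X i := by
            rw [MvPolynomial.X, MvPolynomial.monomial_mul, mul_one]
          have e2 : ∀ k : ℂ, (MvPolynomial.monomial y (c * k) : Poly N) =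
              k • MvPolynomial.monomial y c := by
            intro k
            rw [MvPolynomial.smul_monomial, smul_eq_mul, mul_comm]
          rw [e, e2, map_mul, MvPolynomial.aeval_X, map_smul, mul_smul_comm, mul_smul_comm,
            smul_smul, mul_comm (u i), mul_comm (m.factorial : ℂ)]
        · rw [mul_zero]
    rw [taylorPart_succ, Finset.sum_congr rfl fun i _ => h1 i]
    split_ifs with h
    · rw [← Finset.sum_smul, ← Finset.sum_mul, Nat.factorial_succ, ← h, Finsupp.degree_eq_sum]
      push_cast
      rfl
    · simp

theorem aeval_eq_sum_taylorPart {N : ℕ} (u : Fin N → T) (n : ℕ) (P : Poly N)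
    (hP : ∀ x, MvPolynomial.coeff x P ≠ 0 → Finsupp.degree x ≤ n) :
    MvPolynomial.aeval u P =
      ∑ m ∈ range (n + 1), (1 / (m.factorial : ℂ)) • taylorPart u m P := by
  conv_lhs => rw [P.as_sum, map_sum]
  have h1 : ∀ m, taylorPart u m P = ∑ x ∈ P.support,
      taylorPart u m (MvPolynomial.monomial x (MvPolynomial.coeff x P)) := by
    intro m
    conv_lhs => rw [P.as_sum, taylorPart_sum]
  simp only [h1, Finset.smul_sum]
  rw [Finset.sum_comm]
  refine Finset.sum_congr rfl fun x hx => ?_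
  have hx := hP x (MvPolynomial.mem_support_iff.1 hx)
  rw [Finset.sum_eq_single (Finsupp.degree x)]
  · rw [taylorPart_monomial, if_pos rfl, smul_smul, one_div_mul_cancel, one_smul]
    exact_mod_cast Nat.factorial_ne_zero _
  · intro m _ hm
    rw [taylorPart_monomial, if_neg (Ne.symm hm), smul_zero]
  · intro h
    rw [mem_range] at h
    omega

end Taylor

/-- The parts of a composition of n ≤ N lie between 1 and N, so they are words in `Fin N` through i
↦ N - i, the reversal in ∂/∂t_{N+1-γ}. -/
theorem sum_composition_eq {T : Type*} [AddCommMonoid T] {n N : ℕ} (hn : n ≤ N)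
    (g : List ℕ → T) : ∑ γ : Composition n, g γ.blocks = ∑ m ∈ range (n + 1),
      ∑ f : Fin m → Fin N with ((List.ofFn f).map fun i : Fin N => N - (i : ℕ)).sum = n,
        g ((List.ofFn f).map fun i : Fin N => N - (i : ℕ)) := by
  rw [Finset.sum_sigma']
  have hpos : ∀ (γ : Composition n) (k : Fin γ.length), N - γ.blocksFun k < N := fun γ k => by
    have h1 := γ.one_le_blocksFun k
    have h2 := γ.blocksFun_le k
    omega
  have hinj : Function.Injective (fun i : Fin N => N - (i : ℕ)) := fun i j h => by
    have := i.2
    have := j.2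
    simp only at h
    exact Fin.ext (by omega)
  have hψ : Function.Injective (fun p : (Σ m : ℕ, Fin m → Fin N) =>
      (List.ofFn p.2).map fun i : Fin N => N - (i : ℕ)) := by
    refine (List.map_injective_iff.2 hinj).comp ?_
    exact List.equivSigmaTuple.symm.injective
  have hblocks : ∀ γ : Composition n,
      (List.ofFn fun k => (⟨N - γ.blocksFun k, hpos γ k⟩ : Fin N)).map
        (fun i : Fin N => N - (i : ℕ)) = γ.blocks := fun γ => by
    rw [List.map_ofFn, ← γ.ofFn_blocksFun]
    congr 1
    funext k
    have := γ.blocksFun_le k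
    simp only [Function.comp_apply]
    omega
  refine Finset.sum_bij (fun γ _ => ⟨γ.length, fun k => ⟨N - γ.blocksFun k, hpos γ k⟩⟩) ?_ ?_ ?_ ?_
  · intro γ _
    rw [mem_sigma, mem_range, mem_filter]
    refine ⟨Nat.lt_succ_of_le γ.length_le, mem_univ _, ?_⟩
    simp only
    rw [hblocks, γ.blocks_sum]
  · intro γ _ γ' _ h
    have h2 := congrArg (fun p : (Σ m : ℕ, Fin m → Fin N) =>
      (List.ofFn p.2).map fun i : Fin N => N - (i : ℕ)) h
    simp only at h2
    rw [hblocks, hblocks] at h2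
    exact Composition.ext h2
  · rintro ⟨m, f⟩ hf
    rw [mem_sigma, mem_filter] at hf
    refine ⟨⟨(List.ofFn f).map fun i : Fin N => N - (i : ℕ), ?_, hf.2.2⟩, mem_univ _, ?_⟩
    · intro i hi
      obtain ⟨j, -, rfl⟩ := List.mem_map.1 hi
      have := j.2
      omega
    · apply hψ
      simp only
      rw [hblocks]
  · intro γ _
    simp only
    rw [hblocks]

/-- The weight of an exponent when `t_{j+1}` has weight `N - j`. -/
def expWeight {N : ℕ} (x : Fin N →₀ ℕ) : ℕ := ∑ j, x j * (N - (j : ℕ))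

theorem expWeight_sum_single {N : ℕ} (l : List (Fin N)) :
    expWeight (l.map fun i => Finsupp.single i 1).sum =
      (l.map fun i : Fin N => N - (i : ℕ)).sum := by
  induction l with
  | nil => simp [expWeight]
  | cons i l ih =>
    rw [List.map_cons, List.sum_cons, List.map_cons, List.sum_cons, ← ih, expWeight, expWeight]
    simp only [Finsupp.add_apply, add_mul, Finset.sum_add_distrib]
    congr 1
    rw [Finset.sum_eq_single i]
    · simp
    · intro b _ hb
      rw [Finsupp.single_eq_of_ne hb, zero_mul]
    · simp

theorem degree_le_expWeight {N : ℕ} (x : Fin N →₀ ℕ) : Finsupp.degree x ≤ expWeight x := by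
  rw [Finsupp.degree_eq_sum, expWeight]
  refine Finset.sum_le_sum fun j _ => Nat.le_mul_of_pos_right _ ?_
  have := j.2
  omega

theorem foldr_dPoly {N : ℕ} (l : List (Fin N)) (P : Poly N) :
    (l.map fun i : Fin N => N - (i : ℕ)).foldr (fun g P => dPoly N (N + 1 - g) P) P =
      iterPderiv l P := by
  induction l with
  | nil => rfl
  | cons i l ih =>
    rw [List.map_cons, List.foldr_cons, ih, dPoly, dif_pos (by omega)]
    change _ = MvPolynomial.pderiv i (iterPderiv l P)
    congr 2
    ext
    simp only
    omega

/-- For P homogeneous of weight n, only words of total weight n contribute to the Taylor expansion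
at 0, and these are the compositions of n. -/
theorem sum_composition_taylor {T : Type*} [CommRing T] [Algebra ℂ T] {n N : ℕ} (hn : n ≤ N)
    (U : ℕ → T) (P : Poly N) (hP : ∀ x, MvPolynomial.coeff x P ≠ 0 → expWeight x = n) :
    ∑ γ : Composition n, (1 / (γ.blocks.length.factorial : ℂ) * MvPolynomial.constantCoeff
      (γ.blocks.foldr (fun g P => dPoly N (N + 1 - g) P) P)) • (γ.blocks.map U).prod =
    MvPolynomial.aeval (fun j : Fin N => U (N - (j : ℕ))) P := by
  rw [aeval_eq_sum_taylorPart _ n P fun x hx => hP x hx ▸ degree_le_expWeight x,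
    sum_composition_eq hn (fun l => (1 / (l.length.factorial : ℂ) * MvPolynomial.constantCoeff
      (l.foldr (fun g P => dPoly N (N + 1 - g) P) P)) • (l.map U).prod)]
  refine Finset.sum_congr rfl fun m _ => ?_
  rw [taylorPart, Finset.smul_sum, Finset.sum_filter]
  refine Finset.sum_congr rfl fun f _ => ?_
  rw [foldr_dPoly, List.map_map, List.length_map, List.length_ofFn]
  split_ifs with h
  · rw [mul_smul]
    rfl
  · have h0 : MvPolynomial.constantCoeff (iterPderiv (List.ofFn f) P) = 0 := by
      refine coeff_iterPderiv _ _ _ ?_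
      by_contra hne
      refine h ?_
      rw [← hP _ hne, zero_add, expWeight_sum_single]
    rw [h0, zero_smul, smul_zero]

/-! ### Passage from the potential of type A to type B -/

theorem pderiv_aeval_of_pderiv {σ τ : Type*} [DecidableEq σ] (φ : σ → MvPolynomial τ ℂ)
    (i : τ) (j : σ) (h : ∀ k, MvPolynomial.pderiv i (φ k) = if k = j then 1 else 0)
    (F : MvPolynomial σ ℂ) : MvPolynomial.pderiv i (MvPolynomial.aeval φ F) =
      MvPolynomial.aeval φ (MvPolynomial.pderiv j F) := by
  induction F using MvPolynomial.induction_on with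
  | C a => simp
  | add p q hp hq => simp only [map_add, hp, hq]
  | mul_X p k hp =>
    rw [map_mul, Derivation.leibniz, Derivation.leibniz, hp, MvPolynomial.aeval_X, h, map_add,
      smul_eq_mul, smul_eq_mul, smul_eq_mul, smul_eq_mul, map_mul, map_mul, MvPolynomial.aeval_X]
    congr 2
    split_ifs with hk
    · rw [hk, MvPolynomial.pderiv_X_self, map_one]
    · rw [MvPolynomial.pderiv_X_of_ne hk, map_zero]

/-- The substitution `F_{A_{2N-1}} ↦ F_{B_N}`. -/
def oddSubst (N : ℕ) (j : Fin (2 * N - 1)) : Poly N :=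
  if (j : ℕ) % 2 = 0 then (MvPolynomial.X ⟨(j : ℕ) / 2, by omega⟩ : Poly N) else 0

theorem FB_eq (N : ℕ) : FB N = MvPolynomial.aeval (oddSubst N) (FA (2 * N - 1)) := rfl

theorem pderiv_aeval_oddSubst {N : ℕ} (i : Fin N) (F : Poly (2 * N - 1)) :
    MvPolynomial.pderiv i (MvPolynomial.aeval (oddSubst N) F) =
      MvPolynomial.aeval (oddSubst N) (MvPolynomial.pderiv ⟨2 * i, by omega⟩ F) := by
  refine pderiv_aeval_of_pderiv _ _ _ (fun k => ?_) F
  unfold oddSubst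
  split_ifs with h1 h2 h2
  · subst h2
    have : (⟨2 * (i : ℕ) / 2, by omega⟩ : Fin N) = i := by ext; simp
    simp only [this, MvPolynomial.pderiv_X_self]
  · rw [MvPolynomial.pderiv_X_of_ne]
    intro h
    apply h2
    have := congrArg Fin.val h
    simp only at this
    ext
    simp only
    omega
  · subst h2
    simp at h1
  · simp

theorem coeff_X_mul_pderiv {σ : Type*} (j : σ) (x : σ →₀ ℕ) (p : MvPolynomial σ ℂ) :
    MvPolynomial.coeff x (MvPolynomial.X j * MvPolynomial.pderiv j p) =
      x j * MvPolynomial.coeff x p := by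
  classical
  rw [MvPolynomial.coeff_X_mul']
  split_ifs with h
  · rw [Finsupp.mem_support_iff] at h
    have hle : Finsupp.single j 1 ≤ x := by
      rw [Finsupp.single_le_iff]
      omega
    rw [MvPolynomial.coeff_pderiv, tsub_add_cancel_of_le hle, Finsupp.tsub_apply,
      Finsupp.single_eq_same, Nat.cast_sub (by omega)]
    push_cast
    ring
  · rw [Finsupp.notMem_support_iff.1 h]
    simp

/-- The Euler field in the coordinates of `F_{B_N}`. -/
def eulerB (N : ℕ) : Derivation ℂ (Poly N) (Poly N) :=
  MvPolynomial.mkDerivation ℂ fun j : Fin N =>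
    ((2 * (N - (j : ℕ)) : ℕ) : Poly N) * MvPolynomial.X j

theorem eulerB_apply (N : ℕ) (p : Poly N) : eulerB N p =
    ∑ j : Fin N, ((2 * (N - (j : ℕ)) : ℕ) : Poly N) *
      (MvPolynomial.X j * MvPolynomial.pderiv j p) := by
  have h : eulerB N = ∑ j : Fin N, (((2 * (N - (j : ℕ)) : ℕ) : Poly N) * MvPolynomial.X j) •
      MvPolynomial.pderiv j := by
    refine MvPolynomial.derivation_ext fun k => ?_
    rw [eulerB, MvPolynomial.mkDerivation_X, ← Derivation.coeFnAddMonoidHom_apply (D := ∑ j, _),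
      map_sum, Finset.sum_apply, Finset.sum_eq_single k]
    · simp [Derivation.coeFnAddMonoidHom_apply]
    · intro b _ hb
      simp [Derivation.coeFnAddMonoidHom_apply, MvPolynomial.pderiv_X_of_ne (Ne.symm hb)]
    · simp
  rw [h, ← Derivation.coeFnAddMonoidHom_apply, map_sum, Finset.sum_apply]
  refine Finset.sum_congr rfl fun j _ => ?_
  rw [Derivation.coeFnAddMonoidHom_apply, Derivation.smul_apply, smul_eq_mul, mul_assoc]

theorem coeff_eulerB {N : ℕ} (x : Fin N →₀ ℕ) (p : Poly N) :
    MvPolynomial.coeff x (eulerB N p) = 2 * (expWeight x : ℂ) * MvPolynomial.coeff x p := by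
  rw [eulerB_apply, MvPolynomial.coeff_sum, expWeight, Nat.cast_sum, Finset.mul_sum, Finset.sum_mul]
  refine Finset.sum_congr rfl fun j _ => ?_
  rw [← map_natCast (MvPolynomial.C (R := ℂ) (σ := Fin N)), MvPolynomial.coeff_C_mul,
    coeff_X_mul_pderiv]
  push_cast
  ring

/-- For even k the coordinate t_{k+1} of A_{2N-1} has weight 2N - k = 2(N - k/2); the other
coordinates are set to zero, so the restriction respects weights. -/
theorem eulerB_aeval {N : ℕ} (F : Poly (2 * N - 1)) :
    eulerB N (MvPolynomial.aeval (oddSubst N) F) =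
      MvPolynomial.aeval (oddSubst N) (euler (2 * N - 1) F) := by
  induction F using MvPolynomial.induction_on with
  | C a => simp
  | add p q hp hq => simp only [map_add, hp, hq]
  | mul_X p k hp =>
    rw [map_mul, Derivation.leibniz, Derivation.leibniz, hp, MvPolynomial.aeval_X, map_add, euler_X]
    simp only [smul_eq_mul, map_mul, MvPolynomial.aeval_X, map_natCast]
    congr 2
    unfold oddSubst
    split_ifs with h
    · rw [eulerB, MvPolynomial.mkDerivation_X, wt]
      have hk := k.2
      have : 2 * (N - (k : ℕ) / 2) = 2 * N - 1 + 1 - k := by omega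
      simp only [this]
    · simp

/-- Homogeneity turns the sum over compositions into the value of ∂_α∂_βF_B at the point with
t_{N+1-γ} = U(γ). This is a second derivative of F_{A_{2N-1}} with every other coordinate zero, and
its weight times its value is determined by the recursion. -/
theorem sum_RB {T : Type*} [CommRing T] [Algebra ℂ T] (U : ℕ → T) {e : ℕ → ℕ → T} {α β : ℕ}
    (hα : 1 ≤ α) (hβ : 1 ≤ β)
    (he : SecondDerRec (fun g => if g % 2 = 0 then U (g / 2 + 1) else 0) e (2 * (α + β))) :
    (2 * ((α : ℂ) + β - 1)) •
      ∑ γ : Composition (α + β - 1), RB α β γ.blocks • (γ.blocks.map U).prod =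
      e (2 * (α - 1)) (2 * (β - 1)) := by
  obtain ⟨N, hN⟩ : ∃ N, N = α + β + 1 := ⟨_, rfl⟩
  obtain ⟨i, hi⟩ : ∃ i : Fin N, (i : ℕ) = α - 1 := ⟨⟨α - 1, by omega⟩, rfl⟩
  obtain ⟨j, hj⟩ : ∃ j : Fin N, (j : ℕ) = β - 1 := ⟨⟨β - 1, by omega⟩, rfl⟩
  have hd : ∀ (P : Poly N), dPoly N α P = MvPolynomial.pderiv i P ∧
      dPoly N β P = MvPolynomial.pderiv j P := by
    intro P
    have ei : (⟨α - 1, by omega⟩ : Fin N) = i := Fin.ext hi.symm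
    have ej : (⟨β - 1, by omega⟩ : Fin N) = j := Fin.ext hj.symm
    rw [dPoly, dPoly, dif_pos (by omega), dif_pos (by omega), ei, ej]
    exact ⟨rfl, rfl⟩
  obtain ⟨a, ha⟩ : ∃ a : Fin (2 * N - 1), a = ⟨2 * i, by omega⟩ := ⟨_, rfl⟩
  obtain ⟨b, hb⟩ : ∃ b : Fin (2 * N - 1), b = ⟨2 * j, by omega⟩ := ⟨_, rfl⟩
  obtain ⟨G, hG⟩ : ∃ G, G = MvPolynomial.pderiv a (MvPolynomial.pderiv b (FA (2 * N - 1))) :=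
    ⟨_, rfl⟩
  have hab : (a : ℂ) + b + 2 = 2 * ((α : ℂ) + β - 1) := by
    rw [ha, hb]
    simp only [hi, hj]
    rw [Nat.cast_mul, Nat.cast_mul, Nat.cast_sub hα, Nat.cast_sub hβ]
    push_cast
    ring
  have hP : dPoly N α (dPoly N β (FB N)) = MvPolynomial.aeval (oddSubst N) G := by
    rw [(hd _).1, (hd _).2, FB_eq, pderiv_aeval_oddSubst, pderiv_aeval_oddSubst, hG, ha, hb]
  have hEuler : euler (2 * N - 1) G = MvPolynomial.C ((a : ℂ) + b + 2) * G := by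
    have hF := isPotentialA_FA (Fin.pos a)
    have h := euler_pderiv_of_eq a (euler_pderiv_of_eq b ((eulerEquation_iff _).1 hF.2))
    rw [hG, h]
    congr 2
    ring
  have hwt : ∀ x, MvPolynomial.coeff x (MvPolynomial.aeval (oddSubst N) G) ≠ 0 →
      expWeight x = α + β - 1 := by
    intro x hx
    have h := coeff_eulerB x (MvPolynomial.aeval (oddSubst N) G)
    rw [eulerB_aeval, hEuler, map_mul, hab, MvPolynomial.aeval_C, MvPolynomial.algebraMap_eq,
      MvPolynomial.coeff_C_mul] at h
    have h2 := mul_left_cancel₀ two_ne_zero (mul_right_cancel₀ hx h)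
    have h3 : (((α + β : ℕ) : ℂ)) = ((expWeight x + 1 : ℕ) : ℂ) := by
      push_cast
      linear_combination h2
    have := Nat.cast_injective h3
    omega
  have hsum : ∑ γ : Composition (α + β - 1), RB α β γ.blocks • (γ.blocks.map U).prod =
      MvPolynomial.aeval (fun k : Fin N => U (N - (k : ℕ)))
        (MvPolynomial.aeval (oddSubst N) G) := by
    rw [← sum_composition_taylor (by omega) U _ hwt, ← hP, hN]
    rfl
  obtain ⟨ρ, hρ⟩ : ∃ ρ : Poly (2 * N - 1) →ₐ[ℂ] T, ρ =
    (MvPolynomial.aeval (fun k : Fin N => U (N - (k : ℕ)))).comp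
      (MvPolynomial.aeval (oddSubst N)) := ⟨_, rfl⟩
  have hρG : (2 * ((α : ℂ) + β - 1)) • ρ G = ρ (secondDer a b) := by
    rw [← secondDer_eq, ← hG, hab, ← MvPolynomial.smul_eq_C_mul, map_smul]
  have hρs : ∀ g, g ≤ 2 * (α + β) → ρ (sv (2 * N - 1) (g + 1)) =
      if g % 2 = 0 then U (g / 2 + 1) else 0 := by
    intro g hg
    rw [sv, dif_pos (by omega), hρ, AlgHom.comp_apply, MvPolynomial.aeval_X, oddSubst]
    simp only
    have h1 : (2 * N - 1 - (g + 1)) % 2 = 0 ↔ g % 2 = 0 := by omega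
    simp only [h1]
    split_ifs with h
    · rw [MvPolynomial.aeval_X]
      congr 1
      simp only
      omega
    · rw [map_zero]
  have hrec := (secondDerRec_resid (2 * N - 1)).map ρ.toRingHom
  -- The choice N = α + β + 1 makes the range of the recursion contain the needed total index 2(α -
  -- 1) + 2(β - 1).
  have hM : 2 * N - 1 - 1 = 2 * (α + β) := by omega
  rw [hM] at hrec
  have huniq := hrec.unique he (fun g hg => hρs g hg) a b (by rw [ha, hb]; simp only; omega)
  rw [hsum, ← AlgHom.comp_apply, ← hρ, hρG, secondDer_eq_resid]
  refine huniq.trans ?_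
  rw [ha, hb]
  simp only [hi, hj]

/-! ### Power series in two variables -/

section TwoVar

variable {B : Type*} [CommRing B]

/-- The exponent of `w₀^p w₁^q`. -/
def expo (p q : ℕ) : Fin 2 →₀ ℕ := Finsupp.single 0 p + Finsupp.single 1 q

@[simp] theorem expo_zero (p q : ℕ) : expo p q 0 = p := by simp [expo]

@[simp] theorem expo_one (p q : ℕ) : expo p q 1 = q := by simp [expo]

theorem eq_expo (d : Fin 2 →₀ ℕ) : d = expo (d 0) (d 1) := by
  ext i
  fin_cases i <;> simp

theorem expo_injective {p q p' q' : ℕ} : expo p q = expo p' q' ↔ p = p' ∧ q = q' := by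
  constructor
  · intro h
    exact ⟨by simpa using DFunLike.congr_fun h 0, by simpa using DFunLike.congr_fun h 1⟩
  · rintro ⟨rfl, rfl⟩
    rfl

theorem expo_add (p q p' q' : ℕ) : expo p q + expo p' q' = expo (p + p') (q + q') := by
  ext i
  fin_cases i <;> simp

theorem expo_eq_zero {p q : ℕ} : expo p q = 0 ↔ p = 0 ∧ q = 0 := by
  have : expo 0 0 = 0 := by simp [expo]
  rw [← this, expo_injective]

/-- The coefficient of `w₀^p w₁^q`. -/
def cf (F : MvPowerSeries (Fin 2) B) (p q : ℕ) : B := MvPowerSeries.coeff (expo p q) F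

theorem ext_cf {F G : MvPowerSeries (Fin 2) B} (h : ∀ p q, cf F p q = cf G p q) : F = G := by
  ext d
  rw [eq_expo d]
  exact h _ _

/-- The power series with given coefficients. -/
def ofCf (c : ℕ → ℕ → B) : MvPowerSeries (Fin 2) B := fun d => c (d 0) (d 1)

@[simp] theorem cf_ofCf (c : ℕ → ℕ → B) (p q : ℕ) : cf (ofCf c) p q = c p q := by
  change c (expo p q 0) (expo p q 1) = _
  rw [expo_zero, expo_one]

@[simp] theorem cf_add (F G : MvPowerSeries (Fin 2) B) (p q : ℕ) :
    cf (F + G) p q = cf F p q + cf G p q := map_add _ _ _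

@[simp] theorem cf_sub (F G : MvPowerSeries (Fin 2) B) (p q : ℕ) :
    cf (F - G) p q = cf F p q - cf G p q := map_sub _ _ _

@[simp] theorem cf_neg (F : MvPowerSeries (Fin 2) B) (p q : ℕ) :
    cf (-F) p q = -cf F p q := map_neg _ _

theorem cf_one (p q : ℕ) : cf (1 : MvPowerSeries (Fin 2) B) p q =
    if p = 0 ∧ q = 0 then 1 else 0 := by
  classical
  rw [cf, MvPowerSeries.coeff_one]
  simp only [expo_eq_zero]

theorem cf_mul (F G : MvPowerSeries (Fin 2) B) (p q : ℕ) : cf (F * G) p q =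
    ∑ i ∈ range (p + 1), ∑ j ∈ range (q + 1), cf F i j * cf G (p - i) (q - j) := by
  classical
  rw [cf, MvPowerSeries.coeff_mul, ← Finset.sum_product']
  refine Finset.sum_bij' (fun x _ => (x.1 0, x.1 1))
    (fun y _ => (expo y.1 y.2, expo (p - y.1) (q - y.2))) ?_ ?_ ?_ ?_ ?_
  · rintro ⟨x, y⟩ h
    rw [HasAntidiagonal.mem_antidiagonal] at h
    have h0 := DFunLike.congr_fun h 0
    have h1 := DFunLike.congr_fun h 1
    simp only [Finsupp.add_apply, expo_zero, expo_one] at h0 h1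
    simp only [mem_product, mem_range]
    omega
  · rintro ⟨i, j⟩ h
    simp only [mem_product, mem_range] at h
    rw [HasAntidiagonal.mem_antidiagonal, expo_add, expo_injective]
    omega
  · rintro ⟨x, y⟩ h
    rw [HasAntidiagonal.mem_antidiagonal] at h
    have h0 := DFunLike.congr_fun h 0
    have h1 := DFunLike.congr_fun h 1
    simp only [Finsupp.add_apply, expo_zero, expo_one] at h0 h1
    simp only [Prod.mk.injEq]
    refine ⟨(eq_expo x).symm, ?_⟩
    rw [eq_expo y, expo_injective]
    omega
  · rintro ⟨i, j⟩ _
    simp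
  · rintro ⟨x, y⟩ h
    rw [HasAntidiagonal.mem_antidiagonal] at h
    have h0 := DFunLike.congr_fun h 0
    have h1 := DFunLike.congr_fun h 1
    simp only [Finsupp.add_apply, expo_zero, expo_one] at h0 h1
    simp only [cf]
    have hy : y = expo (p - x 0) (q - x 1) := by
      rw [eq_expo y, expo_injective]
      omega
    rw [← eq_expo x, ← hy]

theorem cf_X_zero_mul (F : MvPowerSeries (Fin 2) B) (p q : ℕ) :
    cf (MvPowerSeries.X 0 * F) p q = if p = 0 then 0 else cf F (p - 1) q := by
  classical
  rw [cf, MvPowerSeries.X_def, MvPowerSeries.coeff_monomial_mul]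
  by_cases hp : p = 0
  · rw [if_neg, if_pos hp]
    rw [Finsupp.single_le_iff, expo_zero]
    omega
  · rw [if_pos, if_neg hp, one_mul, cf]
    · congr 2
      rw [eq_expo (expo p q - _), expo_injective]
      simp
    · rw [Finsupp.single_le_iff, expo_zero]
      omega

theorem cf_X_one_mul (F : MvPowerSeries (Fin 2) B) (p q : ℕ) :
    cf (MvPowerSeries.X 1 * F) p q = if q = 0 then 0 else cf F p (q - 1) := by
  classical
  rw [cf, MvPowerSeries.X_def, MvPowerSeries.coeff_monomial_mul]
  by_cases hq : q = 0
  · rw [if_neg, if_pos hq]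
    rw [Finsupp.single_le_iff, expo_one]
    omega
  · rw [if_pos, if_neg hq, one_mul, cf]
    · congr 2
      rw [eq_expo (expo p q - _), expo_injective]
      simp
    · rw [Finsupp.single_le_iff, expo_one]
      omega

/-- The Euler operator `w₀ ∂/∂w₀ + w₁ ∂/∂w₁`. -/
def theta : Derivation B (MvPowerSeries (Fin 2) B) (MvPowerSeries (Fin 2) B) :=
  Derivation.mk'
    { toFun := fun F => ofCf fun p q => ((p : B) + q) * cf F p q
      map_add' := fun F G => ext_cf fun p q => by simp [mul_add]
      map_smul' := fun a F => ext_cf fun p q => by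
        simp only [RingHom.id_apply]
        have h : ∀ H : MvPowerSeries (Fin 2) B, cf (a • H) p q = a * cf H p q := fun H => by
          rw [cf, MvPowerSeries.coeff_smul, cf]
        rw [h, cf_ofCf, cf_ofCf, h]
        ring }
    (fun F G => ext_cf fun p q => by
      simp only [LinearMap.coe_mk, AddHom.coe_mk, smul_eq_mul]
      rw [mul_comm G, cf_add, cf_ofCf, cf_mul, cf_mul, cf_mul, ← Finset.sum_add_distrib,
        Finset.mul_sum]
      refine Finset.sum_congr rfl fun i hi => ?_
      rw [← Finset.sum_add_distrib, Finset.mul_sum]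
      refine Finset.sum_congr rfl fun j hj => ?_
      rw [mem_range] at hi hj
      rw [cf_ofCf, cf_ofCf, Nat.cast_sub (by omega), Nat.cast_sub (by omega)]
      ring)

theorem cf_theta (F : MvPowerSeries (Fin 2) B) (p q : ℕ) :
    cf (theta F) p q = ((p : B) + q) * cf F p q :=
  cf_ofCf (fun p q => ((p : B) + q) * cf F p q) p q

/-! ### The kernel A and its logarithmic derivative -/

/-- `1 + w₀ w₁ ∑_g s_g (w₀^{g+1} - w₁^{g+1}) / (w₀ - w₁)`. -/
def kernelA (s : ℕ → B) : MvPowerSeries (Fin 2) B := ofCf fun p q =>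
  if p = 0 ∧ q = 0 then 1 else if p = 0 ∨ q = 0 then 0 else s (p + q - 2)

/-- The logarithmic derivative of `kernelA`. -/
def kernelL (s : ℕ → B) : MvPowerSeries (Fin 2) B :=
  theta (kernelA s) * (kernelA s).invOfUnit 1

theorem constantCoeff_eq_cf (F : MvPowerSeries (Fin 2) B) :
    MvPowerSeries.constantCoeff F = cf F 0 0 := by
  rw [← MvPowerSeries.coeff_zero_eq_constantCoeff_apply, cf, expo_eq_zero.2 ⟨rfl, rfl⟩]

theorem kernelA_mul_inv (s : ℕ → B) : kernelA s * (kernelA s).invOfUnit 1 = 1 := by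
  refine MvPowerSeries.mul_invOfUnit _ _ ?_
  rw [constantCoeff_eq_cf, kernelA, cf_ofCf]
  simp

theorem kernelL_mul_kernelA (s : ℕ → B) : kernelL s * kernelA s = theta (kernelA s) := by
  rw [kernelL, mul_assoc, mul_comm _ (kernelA s), kernelA_mul_inv, mul_one]

theorem isUnit_kernelA (s : ℕ → B) : IsUnit (kernelA s) :=
  IsUnit.of_mul_eq_one _ (kernelA_mul_inv s)

/-- `∑_g s_g w₀^{g+2}`. -/
def seriesS (s : ℕ → B) : MvPowerSeries (Fin 2) B := ofCf fun p q =>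
  if q = 0 ∧ 2 ≤ p then s (p - 2) else 0

/-- `∑_g s_g w₁^{g+2}`. -/
def seriesS' (s : ℕ → B) : MvPowerSeries (Fin 2) B := ofCf fun p q =>
  if p = 0 ∧ 2 ≤ q then s (q - 2) else 0

theorem sub_mul_kernelA (s : ℕ → B) :
    (MvPowerSeries.X 1 - MvPowerSeries.X 0) * kernelA s =
      MvPowerSeries.X 1 * (1 - seriesS s) - MvPowerSeries.X 0 * (1 - seriesS' s) := by
  refine ext_cf fun p q => ?_
  rw [sub_mul, cf_sub, cf_sub, cf_X_one_mul, cf_X_zero_mul, cf_X_one_mul, cf_X_zero_mul,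
    cf_sub, cf_sub, cf_one, cf_one, kernelA, seriesS, seriesS']
  simp only [cf_ofCf]
  rcases p with _ | _ | p <;> rcases q with _ | _ | q <;> simp
  · congr 1
    omega
  · rw [sub_eq_zero]
    congr 1
    omega

theorem cf_seriesS_mul (s : ℕ → B) (F : MvPowerSeries (Fin 2) B) (p q : ℕ) :
    cf (seriesS s * F) (p + 2) q = ∑ g ∈ range (p + 1), s g * cf F (p - g) q := by
  rw [cf_mul, Finset.sum_range_succ', Finset.sum_range_succ']
  have h0 : ∀ i < 2, ∑ j ∈ range (q + 1), cf (seriesS s) i j * cf F (p + 2 - i) (q - j) = 0 := by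
    intro i hi
    refine Finset.sum_eq_zero fun j _ => ?_
    rw [seriesS, cf_ofCf, if_neg (by omega), zero_mul]
  rw [h0 0 (by omega), h0 (0 + 1) (by omega), add_zero, add_zero]
  refine Finset.sum_congr rfl fun g _ => ?_
  rw [Finset.sum_eq_single 0]
  · rw [seriesS, cf_ofCf, if_pos ⟨rfl, by omega⟩]
    congr 2
    omega
  · intro j _ hj
    rw [seriesS, cf_ofCf, if_neg (by omega), zero_mul]
  · simp

theorem cf_seriesS'_mul (s : ℕ → B) (F : MvPowerSeries (Fin 2) B) (p q : ℕ) :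
    cf (seriesS' s * F) p (q + 2) = ∑ g ∈ range (q + 1), s g * cf F p (q - g) := by
  rw [cf_mul, Finset.sum_comm, Finset.sum_range_succ', Finset.sum_range_succ']
  have h0 : ∀ j < 2, ∑ i ∈ range (p + 1), cf (seriesS' s) i j * cf F (p - i) (q + 2 - j) = 0 := by
    intro j hj
    refine Finset.sum_eq_zero fun i _ => ?_
    rw [seriesS', cf_ofCf, if_neg (by omega), zero_mul]
  rw [h0 0 (by omega), h0 (0 + 1) (by omega), add_zero, add_zero]
  refine Finset.sum_congr rfl fun g _ => ?_
  rw [Finset.sum_eq_single 0]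
  · rw [seriesS', cf_ofCf, if_pos ⟨rfl, by omega⟩]
    congr 2
    omega
  · intro j _ hj
    rw [seriesS', cf_ofCf, if_neg (by omega), zero_mul]
  · simp

/-- At w₀ = 0 the kernel is 1 and its Euler derivative vanishes. -/
theorem cf_kernelL_zero_left (s : ℕ → B) (q : ℕ) : cf (kernelL s) 0 q = 0 := by
  have h := congrArg (fun F => cf F 0 q) (kernelL_mul_kernelA s)
  simp only [cf_mul, cf_theta, zero_add, Finset.sum_range_one, Nat.sub_zero] at h
  rw [Finset.sum_eq_single q] at h
  · rw [kernelA, cf_ofCf, cf_ofCf, Nat.sub_self, if_pos ⟨rfl, rfl⟩, mul_one] at h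
    rw [h]
    by_cases hq : q = 0
    · simp [hq]
    · rw [if_neg (by omega), if_pos (Or.inl rfl), mul_zero]
  · intro j hj hjq
    rw [mem_range] at hj
    rw [kernelA, cf_ofCf, if_neg (by omega), if_pos (Or.inl rfl), mul_zero]
  · simp

theorem cf_kernelL_zero_right (s : ℕ → B) (p : ℕ) : cf (kernelL s) p 0 = 0 := by
  have h := congrArg (fun F => cf F p 0) (kernelL_mul_kernelA s)
  simp only [cf_mul, cf_theta, zero_add, Finset.sum_range_one, Nat.sub_zero] at h
  rw [Finset.sum_eq_single p] at h
  · rw [kernelA, cf_ofCf, cf_ofCf, Nat.sub_self, if_pos ⟨rfl, rfl⟩, mul_one] at h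
    rw [h]
    by_cases hp : p = 0
    · simp [hp]
    · rw [if_neg (by omega), if_pos (Or.inr rfl), mul_zero]
  · intro j hj hjq
    rw [mem_range] at hj
    rw [kernelA, cf_ofCf, if_neg (by omega), if_pos (Or.inr rfl), mul_zero]
  · simp

/-- Multiply L A = θA by w₁ - w₀, so that A becomes w₁(1 - S(w₀)) - w₀(1 - S(w₁)) with S(w) = ∑_g
s_g w^{g+2}. At w₀^{a+2} w₁^{b+2} the right side vanishes, since coefficients of θA away from the
axes depend only on the total degree. -/
theorem secondDerRec_kernelL (s : ℕ → B) (M : ℕ) :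
    SecondDerRec s (fun a b => cf (kernelL s) (a + 1) (b + 1)) M where
  zero_left n _ := by
    have h := congrArg (fun F => cf F 1 (n + 1)) (kernelL_mul_kernelA s)
    simp only [cf_mul, cf_theta] at h
    rw [Finset.sum_range_succ, Finset.sum_range_one] at h
    simp only [cf_kernelL_zero_left, zero_mul, Finset.sum_const_zero, zero_add] at h
    rw [Finset.sum_eq_single (n + 1)] at h
    · rw [kernelA, cf_ofCf, cf_ofCf, Nat.sub_self, Nat.sub_self, if_pos ⟨rfl, rfl⟩, mul_one,
        if_neg (by omega), if_neg (by omega)] at h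
      rw [zero_add, h]
      have e : 1 + (n + 1) - 2 = n := by omega
      rw [e]
      push_cast
      ring
    · intro j hj hjn
      rw [mem_range] at hj
      rw [kernelA, cf_ofCf, if_neg (by omega), if_pos (Or.inl (by omega)), mul_zero]
    · simp
  succ_left a b _ := by
    have h : (MvPowerSeries.X 1 * (1 - seriesS s) - MvPowerSeries.X 0 * (1 - seriesS' s)) *
        kernelL s = (MvPowerSeries.X 1 - MvPowerSeries.X 0) * theta (kernelA s) := by
      rw [← sub_mul_kernelA, ← kernelL_mul_kernelA]
      ring
    have h1 : MvPowerSeries.X 1 * (kernelL s - seriesS s * kernelL s) -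
        MvPowerSeries.X 0 * (kernelL s - seriesS' s * kernelL s) =
        MvPowerSeries.X 1 * theta (kernelA s) - MvPowerSeries.X 0 * theta (kernelA s) := by
      rw [← sub_mul, ← h]
      ring
    have h2 := congrArg (fun F => cf F (a + 2) (b + 2)) h1
    simp only [cf_sub, cf_X_one_mul, cf_X_zero_mul] at h2
    rw [if_neg (by omega), if_neg (by omega), if_neg (by omega), if_neg (by omega)] at h2
    have ea : a + 2 - 1 = a + 1 := by omega
    have eb : b + 2 - 1 = b + 1 := by omega
    rw [ea, eb, cf_seriesS_mul, cf_seriesS'_mul, Finset.sum_range_succ, Finset.sum_range_succ _ b,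
      Nat.sub_self, Nat.sub_self, cf_kernelL_zero_left, cf_kernelL_zero_right, mul_zero, mul_zero,
      add_zero, add_zero, cf_theta, cf_theta, kernelA, cf_ofCf, cf_ofCf, if_neg (by omega),
      if_neg (by omega), if_neg (by omega), if_neg (by omega)] at h2
    have e : a + 2 + (b + 1) - 2 = a + 1 + (b + 2) - 2 := by omega
    rw [e] at h2
    push_cast at h2
    have hA : ∑ g ∈ range a, s g * cf (kernelL s) (a - g) (b + 1) =
        ∑ g ∈ range a, s g * cf (kernelL s) (a - (g + 1) + 1) (b + 1) := by
      refine Finset.sum_congr rfl fun g hg => ?_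
      rw [mem_range] at hg
      congr 2
      omega
    have hB : ∑ g ∈ range b, s g * cf (kernelL s) (a + 1) (b - g) =
        ∑ g ∈ range b, s g * cf (kernelL s) (a + 1) (b - (g + 1) + 1) := by
      refine Finset.sum_congr rfl fun g hg => ?_
      rw [mem_range] at hg
      congr 2
      omega
    rw [hA, hB] at h2
    linear_combination h2

/-- The substitution `w_i ↦ ε_i w_i`. -/
abbrev signs (ε : Fin 2 → B) : MvPowerSeries (Fin 2) B →+* MvPowerSeries (Fin 2) B :=
  MvPowerSeries.rescale ε

theorem cf_signs (ε : Fin 2 → B) (F : MvPowerSeries (Fin 2) B) (p q : ℕ) :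
    cf (signs ε F) p q = ε 0 ^ p * ε 1 ^ q * cf F p q := by
  rw [cf, signs, MvPowerSeries.coeff_rescale, cf, Finsupp.prod_fintype _ _ (fun i => pow_zero _),
    Fin.prod_univ_two, expo_zero, expo_one]

theorem theta_signs (ε : Fin 2 → B) (F : MvPowerSeries (Fin 2) B) :
    theta (signs ε F) = signs ε (theta F) := by
  refine ext_cf fun p q => ?_
  rw [cf_theta, cf_signs, cf_signs, cf_theta]
  ring

theorem theta_pow_eq (F : MvPowerSeries (Fin 2) B) (n : ℕ) :
    theta (F ^ (n + 1)) = ((n : MvPowerSeries (Fin 2) B) + 1) * (F ^ n * theta F) := by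
  rw [Derivation.leibniz_pow, Nat.add_sub_cancel, nsmul_eq_mul, smul_eq_mul]
  push_cast
  ring

/-! ### Exponentials and passage to logarithmic derivatives -/

variable [Algebra ℂ B]

theorem natCast_mul_eq_zero {n : ℕ} (hn : n ≠ 0) {x : B} (h : (n : B) * x = 0) : x = 0 := by
  have h1 : (algebraMap ℂ B (1 / n)) * (n : B) = 1 := by
    rw [← map_natCast (algebraMap ℂ B), ← map_mul, one_div_mul_cancel (by exact_mod_cast hn),
      map_one]
  calc x = (algebraMap ℂ B (1 / n)) * (n : B) * x := by rw [h1, one_mul]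
    _ = 0 := by rw [mul_assoc, h, mul_zero]

theorem eq_one_of_theta_eq_zero {F : MvPowerSeries (Fin 2) B} (h : theta F = 0) (h1 : cf F 0 0 = 1) :
    F = 1 := by
  refine ext_cf fun p q => ?_
  rw [cf_one]
  split_ifs with hpq
  · rw [hpq.1, hpq.2, h1]
  · have h2 := cf_theta F p q
    rw [h, show cf (0 : MvPowerSeries (Fin 2) B) p q = 0 from map_zero _] at h2
    refine natCast_mul_eq_zero (n := p + q) (by omega) ?_
    rw [h2]
    push_cast
    rfl

/-- Truncated exponentials. -/
def expTrunc (M : ℕ) (F : MvPowerSeries (Fin 2) B) : MvPowerSeries (Fin 2) B :=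
  ∑ n ∈ range M, (algebraMap ℂ (MvPowerSeries (Fin 2) B) (1 / (n.factorial : ℂ))) * F ^ n

/-- Without constant term, F^n begins in degree n, so truncation does not change low coefficients.
-/
theorem cf_exp_subst {F : MvPowerSeries (Fin 2) B} (hF : cf F 0 0 = 0) {p q M : ℕ}
    (hM : p + q < M) : cf ((PowerSeries.exp ℂ).subst F) p q = cf (expTrunc M F) p q := by
  have hc : MvPowerSeries.constantCoeff F = 0 := by rw [constantCoeff_eq_cf, hF]
  rw [cf, PowerSeries.coeff_subst (PowerSeries.HasSubst.of_constantCoeff_zero hc),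
    finsum_eq_sum_of_support_subset (s := range M), expTrunc, cf, map_sum]
  · refine Finset.sum_congr rfl fun n _ => ?_
    rw [← Algebra.smul_def]
    have : (MvPowerSeries.coeff (expo p q)) ((1 / (n.factorial : ℂ)) • F ^ n) =
        (1 / (n.factorial : ℂ)) • (MvPowerSeries.coeff (expo p q)) (F ^ n) := rfl
    rw [this, PowerSeries.coeff_exp]
    simp
  · intro n hn
    rw [Function.mem_support] at hn
    by_contra hnM
    simp only [coe_range, Set.mem_Iio, not_lt] at hnM
    apply hn
    rw [MvPowerSeries.coeff_eq_zero_of_constantCoeff_nilpotent (m := 1) (by rw [hc, pow_one]),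
      smul_zero]
    rw [Finsupp.degree_eq_sum, Fin.sum_univ_two, expo_zero, expo_one]
    omega

theorem theta_expTrunc (M : ℕ) (F : MvPowerSeries (Fin 2) B) :
    theta (expTrunc (M + 1) F) = expTrunc M F * theta F := by
  have hθ : ∀ (c : ℂ) (G : MvPowerSeries (Fin 2) B),
      theta (algebraMap ℂ (MvPowerSeries (Fin 2) B) c * G) = algebraMap ℂ _ c * theta G := by
    intro c G
    have : algebraMap ℂ (MvPowerSeries (Fin 2) B) c = algebraMap B _ (algebraMap ℂ B c) :=
      IsScalarTower.algebraMap_apply ℂ B _ c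
    rw [this, ← Algebra.smul_def, Derivation.map_smul, Algebra.smul_def]
  rw [expTrunc, map_sum, expTrunc, Finset.sum_mul, Finset.sum_range_succ']
  have h0 : theta (algebraMap ℂ (MvPowerSeries (Fin 2) B) (1 / (Nat.factorial 0 : ℂ)) * F ^ 0) =
      0 := by
    rw [hθ, pow_zero, Derivation.map_one_eq_zero, mul_zero]
  rw [h0, add_zero]
  refine Finset.sum_congr rfl fun n _ => ?_
  rw [hθ, theta_pow_eq]
  have e : algebraMap ℂ (MvPowerSeries (Fin 2) B) (1 / ((n + 1).factorial : ℂ)) *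
      ((n : MvPowerSeries (Fin 2) B) + 1) = algebraMap ℂ _ (1 / (n.factorial : ℂ)) := by
    have hn : (n : ℂ) + 1 ≠ 0 := by exact_mod_cast Nat.succ_ne_zero n
    have hf : (n.factorial : ℂ) ≠ 0 := by exact_mod_cast Nat.factorial_ne_zero n
    rw [← map_natCast (algebraMap ℂ (MvPowerSeries (Fin 2) B)) n,
      ← map_one (algebraMap ℂ (MvPowerSeries (Fin 2) B)), ← map_add, ← map_mul]
    congr 1
    rw [Nat.factorial_succ]
    push_cast
    field_simp
  rw [← mul_assoc, e, mul_assoc]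

theorem theta_exp_subst {F : MvPowerSeries (Fin 2) B} (hF : cf F 0 0 = 0) :
    theta ((PowerSeries.exp ℂ).subst F) = (PowerSeries.exp ℂ).subst F * theta F := by
  refine ext_cf fun p q => ?_
  rw [cf_theta, cf_exp_subst hF (M := p + q + 1 + 1) (by omega), ← cf_theta, theta_expTrunc,
    cf_mul, cf_mul]
  refine Finset.sum_congr rfl fun i hi => Finset.sum_congr rfl fun j hj => ?_
  rw [mem_range] at hi hj
  rw [cf_exp_subst hF (M := p + q + 1) (by omega)]

theorem cf_exp_subst_zero {F : MvPowerSeries (Fin 2) B} (hF : cf F 0 0 = 0) :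
    cf ((PowerSeries.exp ℂ).subst F) 0 0 = 1 := by
  rw [cf_exp_subst hF (M := 1) (by omega), expTrunc, Finset.sum_range_one]
  simp [cf_one]

/-- `A(εw) exp(Ψ) = A(w)` in terms of logarithmic derivatives. -/
theorem kernelA_exp_iff (s : ℕ → B) (ε : Fin 2 → B) {F : MvPowerSeries (Fin 2) B}
    (hF : cf F 0 0 = 0) : signs ε (kernelA s) * (PowerSeries.exp ℂ).subst F = kernelA s ↔
      theta F = kernelL s - signs ε (kernelL s) := by
  set E : MvPowerSeries (Fin 2) B := (PowerSeries.exp ℂ).subst F with hE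
  have hθE : theta E = E * theta F := theta_exp_subst hF
  have hL := kernelL_mul_kernelA s
  have hL' : theta (signs ε (kernelA s)) = signs ε (kernelL s) * signs ε (kernelA s) := by
    rw [theta_signs, ← hL, map_mul]
  constructor
  · intro h
    have h2 := congrArg theta h
    rw [Derivation.leibniz, hθE, hL', ← hL] at h2
    simp only [smul_eq_mul] at h2
    have h3 : kernelA s * theta F = kernelA s * (kernelL s - signs ε (kernelL s)) := by
      linear_combination h2 - (theta F + signs ε (kernelL s)) * h
    exact (isUnit_kernelA s).mul_left_cancel h3
  · intro h
    obtain ⟨I, hI⟩ : ∃ I, kernelA s * I = 1 := ⟨_, kernelA_mul_inv s⟩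
    have hθI : theta I = -(kernelL s * I) := by
      have h2 := congrArg theta hI
      rw [Derivation.leibniz, Derivation.map_one_eq_zero, ← hL] at h2
      simp only [smul_eq_mul] at h2
      refine (isUnit_kernelA s).mul_left_cancel ?_
      linear_combination h2
    -- The quotient of the two sides has zero logarithmic derivative and constant term 1, hence
    -- equals 1.
    have hY : signs ε (kernelA s) * E * I = 1 := by
      refine eq_one_of_theta_eq_zero ?_ ?_
      · rw [Derivation.leibniz, Derivation.leibniz, hθI, hθE, hL', h]
        simp only [smul_eq_mul]
        ring
      · have hc := congrArg MvPowerSeries.constantCoeff hI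
        rw [map_mul, map_one, constantCoeff_eq_cf, kernelA, cf_ofCf, if_pos ⟨rfl, rfl⟩,
          one_mul] at hc
        rw [← constantCoeff_eq_cf, map_mul, map_mul, hc, constantCoeff_eq_cf, constantCoeff_eq_cf,
          hE, cf_exp_subst_zero hF, cf_signs, kernelA, cf_ofCf]
        simp
    linear_combination kernelA s * hY - signs ε (kernelA s) * E * hI

/-- When s is supported on even indices, A, and therefore L, is invariant under (w₀, w₁) ↦ (-w₀,
-w₁). -/
theorem kernelL_parity {s : ℕ → B} (hs : ∀ g, g % 2 = 1 → s g = 0) {p q : ℕ}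
    (hpq : (p + q) % 2 = 1) : cf (kernelL s) p q = 0 := by
  have hA : signs (fun _ => (-1 : B)) (kernelA s) = kernelA s := by
    refine ext_cf fun p q => ?_
    rw [cf_signs, kernelA, cf_ofCf, ← pow_add]
    split_ifs with h1 h2
    · rw [h1.1, h1.2]; simp
    · simp
    · by_cases h : (p + q) % 2 = 0
      · rw [Even.neg_one_pow (Nat.even_iff.2 h), one_mul]
      · rw [hs _ (by omega), mul_zero]
  have h1 := congrArg (signs (fun _ => (-1 : B))) (kernelL_mul_kernelA s)
  rw [map_mul, hA, ← theta_signs, hA, ← kernelL_mul_kernelA] at h1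
  have h2 := (isUnit_kernelA s).mul_right_cancel h1
  have h3 := cf_signs (fun _ => (-1 : B)) (kernelL s) p q
  rw [h2, ← pow_add, Odd.neg_one_pow (Nat.odd_iff.2 hpq)] at h3
  refine natCast_mul_eq_zero (n := 2) two_ne_zero ?_
  push_cast
  linear_combination h3

end TwoVar

/-! ### The dispersionless BKP hierarchy in terms of coefficients -/

section Kernel

variable {B : Type*} [CommRing B]

/-- `∑_g s_g (w₀^{g+1} - w₁^{g+1})`. -/
def diffSeries (s : ℕ → B) : MvPowerSeries (Fin 2) B := ofCf fun p q =>
  if q = 0 ∧ 1 ≤ p then s (p - 1) else if p = 0 ∧ 1 ≤ q then -s (q - 1) else 0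

/-- `∑_g s_g (w₀^{g+1} + w₁^{g+1})`. -/
def sumSeries (s : ℕ → B) : MvPowerSeries (Fin 2) B := ofCf fun p q =>
  if q = 0 ∧ 1 ≤ p then s (p - 1) else if p = 0 ∧ 1 ≤ q then s (q - 1) else 0

theorem cf_X_zero (p q : ℕ) : cf (MvPowerSeries.X 0 : MvPowerSeries (Fin 2) B) p q =
    if p = 1 ∧ q = 0 then 1 else 0 := by
  rw [← mul_one (MvPowerSeries.X 0), cf_X_zero_mul, cf_one]
  split_ifs <;> first | rfl | omega

theorem cf_X_one (p q : ℕ) : cf (MvPowerSeries.X 1 : MvPowerSeries (Fin 2) B) p q =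
    if p = 0 ∧ q = 1 then 1 else 0 := by
  rw [← mul_one (MvPowerSeries.X 1), cf_X_one_mul, cf_one]
  split_ifs <;> first | rfl | omega

theorem sub_mul_kernelA_eq_diffSeries (s : ℕ → B) :
    (MvPowerSeries.X 1 - MvPowerSeries.X 0) * kernelA s =
      (MvPowerSeries.X 1 - MvPowerSeries.X 0) -
        MvPowerSeries.X 0 * (MvPowerSeries.X 1 * diffSeries s) := by
  rw [sub_mul_kernelA]
  refine ext_cf fun p q => ?_
  simp only [cf_sub, cf_X_one_mul, cf_X_zero_mul, cf_one, cf_X_zero, cf_X_one, seriesS, seriesS',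
    diffSeries, cf_ofCf]
  rcases p with _ | _ | p <;> rcases q with _ | _ | q <;> simp

/-- The signs of the substitution `w₁ ↦ -w₁`. -/
def flipOne : Fin 2 → B := fun i => if i = 0 then 1 else -1

theorem cf_signs_flipOne (F : MvPowerSeries (Fin 2) B) (p q : ℕ) :
    cf (signs flipOne F) p q = (-1) ^ q * cf F p q := by
  rw [cf_signs]
  simp [flipOne]

/-- Replace w₁ by -w₁ in `sub_mul_kernelA_eq_diffSeries`: only odd powers of w₁ occur in the
difference series, so it becomes the sum series. -/
theorem add_mul_signs_kernelA {s : ℕ → B} (hs : ∀ g, g % 2 = 1 → s g = 0) :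
    (MvPowerSeries.X 1 + MvPowerSeries.X 0) * signs flipOne (kernelA s) =
      (MvPowerSeries.X 1 + MvPowerSeries.X 0) -
        MvPowerSeries.X 0 * (MvPowerSeries.X 1 * sumSeries s) := by
  have h0 : signs flipOne (MvPowerSeries.X 0 : MvPowerSeries (Fin 2) B) = MvPowerSeries.X 0 :=
    ext_cf fun p q => by
      rw [cf_signs_flipOne, cf_X_zero]
      split_ifs with h
      · rw [h.2, pow_zero, one_mul]
      · rw [mul_zero]
  have h1 : signs flipOne (MvPowerSeries.X 1 : MvPowerSeries (Fin 2) B) = -MvPowerSeries.X 1 :=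
    ext_cf fun p q => by
      rw [cf_signs_flipOne, cf_neg, cf_X_one]
      split_ifs with h
      · rw [h.2, pow_one, mul_one]
      · rw [mul_zero, neg_zero]
  have h2 : signs flipOne (diffSeries s) = sumSeries s := ext_cf fun p q => by
    rw [cf_signs_flipOne, diffSeries, sumSeries, cf_ofCf, cf_ofCf]
    split_ifs with h h'
    · rw [h.1, pow_zero, one_mul]
    · by_cases hq : q % 2 = 1
      · rw [Odd.neg_one_pow (Nat.odd_iff.2 hq)]
        ring
      · rw [hs _ (by omega)]
        simp
    · rw [mul_zero]
  have h := congrArg (signs flipOne) (sub_mul_kernelA_eq_diffSeries s)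
  simp only [map_mul, map_sub, h0, h1, h2] at h
  linear_combination -h

end Kernel

theorem div_inv_sub_inv {k : Type*} [Field k] {w₀ w₁ a u : k} (h0 : w₀ ≠ 0) (h1 : w₁ ≠ 0)
    (h : w₁ - w₀ ≠ 0) (ha : (w₁ - w₀) * a = (w₁ - w₀) - w₀ * (w₁ * u)) :
    1 - u / (w₀⁻¹ - w₁⁻¹) = a := by
  rw [inv_sub_inv h0 h1]
  field_simp
  linear_combination -ha

theorem div_inv_add_inv {k : Type*} [Field k] {w₀ w₁ a u : k} (h0 : w₀ ≠ 0) (h1 : w₁ ≠ 0)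
    (h : w₁ + w₀ ≠ 0) (ha : (w₁ + w₀) * a = (w₁ + w₀) - w₀ * (w₁ * u)) :
    1 - u / (w₀⁻¹ + w₁⁻¹) = a := by
  rw [inv_add_inv h0 h1, add_comm w₀]
  field_simp
  linear_combination -ha

theorem toF_injective : Function.Injective toF := IsFractionRing.injective ZSeries ZField

theorem toF_mul (F G : ZSeries) : toF (F * G) = toF F * toF G := map_mul _ _ _

theorem toF_add (F G : ZSeries) : toF (F + G) = toF F + toF G := map_add _ _ _

theorem toF_sub (F G : ZSeries) : toF (F - G) = toF F - toF G := map_sub _ _ _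

theorem toF_ne_zero {F : ZSeries} {p q : ℕ} (h : cf F p q ≠ 0) : toF F ≠ 0 := by
  intro h0
  have : F = 0 := toF_injective (h0.trans (map_zero (algebraMap ZSeries ZField)).symm)
  exact h (by rw [this]; exact map_zero _)

/-- Since 1/(z₁ - z₂) = w₀w₁/(w₁ - w₀), the two fractions in the hierarchy combine to A(w₀, w₁) and
A(w₀, -w₁), which are power series. -/
theorem bkp_equation_iff {s : ℕ → TSeries} (hs : ∀ g, g % 2 = 1 → s g = 0) (E : ZSeries) :
    (1 - toF (sumSeries s) / (z 0 + z 1)) * toF E = 1 - toF (diffSeries s) / (z 0 - z 1) ↔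
      signs flipOne (kernelA s) * E = kernelA s := by
  have h0 : toF (MvPowerSeries.X 0) ≠ 0 := toF_ne_zero (p := 1) (q := 0) (by
    rw [cf_X_zero]; simp)
  have h1 : toF (MvPowerSeries.X 1) ≠ 0 := toF_ne_zero (p := 0) (q := 1) (by
    rw [cf_X_one]; simp)
  have hsub : toF (MvPowerSeries.X 1) - toF (MvPowerSeries.X 0) ≠ 0 := by
    have : toF (MvPowerSeries.X 1 - MvPowerSeries.X 0) ≠ 0 := toF_ne_zero (p := 0) (q := 1) (by
      rw [cf_sub, cf_X_one, cf_X_zero]; simp)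
    rwa [toF_sub] at this
  have hadd : toF (MvPowerSeries.X 1) + toF (MvPowerSeries.X 0) ≠ 0 := by
    have : toF (MvPowerSeries.X 1 + MvPowerSeries.X 0) ≠ 0 := toF_ne_zero (p := 0) (q := 1) (by
      rw [cf_add, cf_X_one, cf_X_zero]; simp)
    rwa [toF_add] at this
  have hA := congrArg toF (sub_mul_kernelA_eq_diffSeries s)
  have hA' := congrArg toF (add_mul_signs_kernelA hs)
  simp only [toF_mul, toF_sub, toF_add] at hA hA'
  rw [z, z, div_inv_sub_inv h0 h1 hsub hA, div_inv_add_inv h0 h1 hadd hA']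
  exact ⟨fun h => toF_injective (by rw [toF_mul]; exact h), fun h => by
    conv_rhs => rw [← h]
    exact (toF_mul _ _).symm⟩

/-! ### The series of the dispersionless BKP hierarchy -/

theorem dOdd_smul (n : ℕ) (c : ℂ) (F : TSeries) : dOdd n (c • F) = c • dOdd n F :=
  Derivation.map_smul _ _ _

theorem dOdd_zero_right (n : ℕ) : dOdd n 0 = 0 := map_zero _

/-- The second derivatives of `f`, before the times are rescaled. -/
def secondF (F₀ : TSeries) (n m : ℕ) : TSeries :=
  (2 / ((2 * (n : ℂ) + 1) * (2 * m + 1))) • dOdd n (dOdd m F₀)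

/-- The coordinates `s`, specialized to the second derivatives of `f`. -/
def oddCoord (F₀ : TSeries) (g : ℕ) : TSeries := if g % 2 = 0 then secondF F₀ 0 (g / 2) else 0

/-- As G does not involve w₀, only the term with 2n + 1 = p survives. -/
theorem cf_DB_zero {G : ZSeries} (hG : ∀ p q, p ≠ 0 → cf G p q = 0) (p q : ℕ) :
    cf (DB 0 G) p q = if p % 2 = 1 then
      (1 / (2 * ((p / 2 : ℕ) : ℂ) + 1)) • dOdd (p / 2) (cf G 0 q) else 0 := by
  have h : cf (DB 0 G) p q = ∑ n ∈ range p, if 2 * n + 1 ≤ p then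
      (1 / (2 * (n : ℂ) + 1)) • dOdd n (cf G (p - (2 * n + 1)) q) else 0 := by
    change (∑ n ∈ range (expo p q 0), if 2 * n + 1 ≤ expo p q 0 then (1 / (2 * (n : ℂ) + 1)) •
      dOdd n (MvPowerSeries.coeff (expo p q - Finsupp.single 0 (2 * n + 1)) G) else 0) = _
    rw [expo_zero]
    refine Finset.sum_congr rfl fun n _ => ?_
    have e : expo p q - Finsupp.single 0 (2 * n + 1) = expo (p - (2 * n + 1)) q := by
      rw [eq_expo (expo p q - _), expo_injective]
      simp
    rw [e, cf]
  rw [h]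
  split_ifs with hp
  · rw [Finset.sum_eq_single (p / 2)]
    · rw [if_pos (by omega)]
      congr 3
      omega
    · intro n _ hn
      split_ifs with hnp
      · rw [hG _ _ (by omega), dOdd_zero_right, smul_zero]
      · rfl
    · intro hn
      rw [mem_range] at hn
      omega
  · refine Finset.sum_eq_zero fun n _ => ?_
    split_ifs with hnp
    · rw [hG _ _ (by omega), dOdd_zero_right, smul_zero]
    · rfl

theorem cf_DB_one {G : ZSeries} (hG : ∀ p q, q ≠ 0 → cf G p q = 0) (p q : ℕ) :
    cf (DB 1 G) p q = if q % 2 = 1 then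
      (1 / (2 * ((q / 2 : ℕ) : ℂ) + 1)) • dOdd (q / 2) (cf G p 0) else 0 := by
  have h : cf (DB 1 G) p q = ∑ n ∈ range q, if 2 * n + 1 ≤ q then
      (1 / (2 * (n : ℂ) + 1)) • dOdd n (cf G p (q - (2 * n + 1))) else 0 := by
    change (∑ n ∈ range (expo p q 1), if 2 * n + 1 ≤ expo p q 1 then (1 / (2 * (n : ℂ) + 1)) •
      dOdd n (MvPowerSeries.coeff (expo p q - Finsupp.single 1 (2 * n + 1)) G) else 0) = _
    rw [expo_one]
    refine Finset.sum_congr rfl fun n _ => ?_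
    have e : expo p q - Finsupp.single 1 (2 * n + 1) = expo p (q - (2 * n + 1)) := by
      rw [eq_expo (expo p q - _), expo_injective]
      simp
    rw [e, cf]
  rw [h]
  split_ifs with hq
  · rw [Finset.sum_eq_single (q / 2)]
    · rw [if_pos (by omega)]
      congr 3
      omega
    · intro n _ hn
      split_ifs with hnp
      · rw [hG _ _ (by omega), dOdd_zero_right, smul_zero]
      · rfl
    · intro hn
      rw [mem_range] at hn
      omega
  · refine Finset.sum_eq_zero fun n _ => ?_
    split_ifs with hnp
    · rw [hG _ _ (by omega), dOdd_zero_right, smul_zero]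
    · rfl

theorem cf_two_mul (G : ZSeries) (p q : ℕ) : cf (2 * G) p q = 2 * cf G p q := by
  rw [two_mul, cf_add, two_mul]

theorem cf_C (F₀ : TSeries) (p q : ℕ) :
    cf (MvPowerSeries.C F₀ : ZSeries) p q = if p = 0 ∧ q = 0 then F₀ else 0 := by
  classical
  rw [cf, MvPowerSeries.coeff_C]
  simp only [expo_eq_zero]

theorem cf_dFirst (G : ZSeries) (p q : ℕ) : cf (dFirst G) p q = dOdd 0 (cf G p q) := rfl

theorem two_mul_smul_eq (c : ℂ) (F : TSeries) : 2 * c • F = (2 * c) • F := by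
  rw [two_mul, ← add_smul, ← two_mul]

theorem cf_two_DB_zero_C (F₀ : TSeries) (p q : ℕ) : cf (2 * DB 0 (MvPowerSeries.C F₀)) p q =
    if q = 0 ∧ p % 2 = 1 then
      (2 / (2 * ((p / 2 : ℕ) : ℂ) + 1)) • dOdd (p / 2) F₀ else 0 := by
  rw [cf_two_mul, cf_DB_zero (fun p q hp => by rw [cf_C, if_neg (by omega)]), cf_C]
  by_cases hp : p % 2 = 1
  · by_cases hq : q = 0
    · rw [if_pos hp, if_pos ⟨rfl, hq⟩, if_pos ⟨hq, hp⟩, two_mul_smul_eq, mul_one_div]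
    · rw [if_pos hp, if_neg (by omega), if_neg (by omega), dOdd_zero_right, smul_zero, mul_zero]
  · rw [if_neg hp, if_neg (by omega), mul_zero]

theorem cf_two_DB_one_C (F₀ : TSeries) (p q : ℕ) : cf (2 * DB 1 (MvPowerSeries.C F₀)) p q =
    if p = 0 ∧ q % 2 = 1 then
      (2 / (2 * ((q / 2 : ℕ) : ℂ) + 1)) • dOdd (q / 2) F₀ else 0 := by
  rw [cf_two_mul, cf_DB_one (fun p q hq => by rw [cf_C, if_neg (by omega)]), cf_C]
  by_cases hq : q % 2 = 1
  · by_cases hp : p = 0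
    · rw [if_pos hq, if_pos ⟨hp, rfl⟩, if_pos ⟨hp, hq⟩, two_mul_smul_eq, mul_one_div]
    · rw [if_pos hq, if_neg (by omega), if_neg (by omega), dOdd_zero_right, smul_zero, mul_zero]
  · rw [if_neg hq, if_neg (by omega), mul_zero]

theorem cf_two_DB_two_DB_C (F₀ : TSeries) (p q : ℕ) :
    cf (2 * DB 0 (2 * DB 1 (MvPowerSeries.C F₀))) p q =
      if p % 2 = 1 ∧ q % 2 = 1 then 2 * secondF F₀ (p / 2) (q / 2) else 0 := by
  rw [cf_two_mul, cf_DB_zero (fun p q hp => by rw [cf_two_DB_one_C, if_neg (by omega)]),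
    cf_two_DB_one_C]
  by_cases hp : p % 2 = 1
  · by_cases hq : q % 2 = 1
    · rw [if_pos hp, if_pos ⟨rfl, hq⟩, if_pos ⟨hp, hq⟩, dOdd_smul, smul_smul, secondF]
      congr 2
      rw [div_mul_div_comm, one_mul]
    · rw [if_pos hp, if_neg (by omega), if_neg (by omega), dOdd_zero_right, smul_zero, mul_zero]
  · rw [if_neg hp, if_neg (by omega), mul_zero]

theorem dOdd_zero_smul (F₀ : TSeries) (m : ℕ) :
    dOdd 0 ((2 / (2 * (m : ℂ) + 1)) • dOdd m F₀) = secondF F₀ 0 m := by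
  rw [dOdd_smul, secondF, Nat.cast_zero, mul_zero, zero_add, one_mul]

theorem oddCoord_pred (F₀ : TSeries) {p : ℕ} (hp : 1 ≤ p) :
    oddCoord F₀ (p - 1) = if p % 2 = 1 then secondF F₀ 0 (p / 2) else 0 := by
  rw [oddCoord]
  by_cases h : p % 2 = 1
  · rw [if_pos (by omega), if_pos h]
    congr 1
    omega
  · rw [if_neg (by omega), if_neg h]

theorem dFirst_sub_eq (F₀ : TSeries) : dFirst (2 * DB 0 (MvPowerSeries.C F₀) -
    2 * DB 1 (MvPowerSeries.C F₀)) = diffSeries (oddCoord F₀) := by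
  refine ext_cf fun p q => ?_
  have hsub : ∀ F G : TSeries, dOdd 0 (F - G) = dOdd 0 F - dOdd 0 G := fun F G => map_sub _ _ _
  rw [cf_dFirst, cf_sub, hsub, cf_two_DB_zero_C, cf_two_DB_one_C, diffSeries, cf_ofCf]
  by_cases h1 : q = 0 ∧ 1 ≤ p
  · rw [if_pos h1, if_neg (by omega : ¬(p = 0 ∧ q % 2 = 1)), dOdd_zero_right, sub_zero,
      oddCoord_pred F₀ h1.2]
    by_cases h : p % 2 = 1
    · rw [if_pos ⟨h1.1, h⟩, if_pos h, dOdd_zero_smul]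
    · rw [if_neg (by omega), if_neg h, dOdd_zero_right]
  · rw [if_neg h1, if_neg (by omega : ¬(q = 0 ∧ p % 2 = 1)), dOdd_zero_right, zero_sub]
    by_cases h2 : p = 0 ∧ 1 ≤ q
    · rw [if_pos h2, oddCoord_pred F₀ h2.2]
      by_cases h : q % 2 = 1
      · rw [if_pos ⟨h2.1, h⟩, if_pos h, dOdd_zero_smul]
      · rw [if_neg (by omega), if_neg h, dOdd_zero_right]
    · rw [if_neg h2, if_neg (by omega), dOdd_zero_right, neg_zero]

theorem dFirst_add_eq (F₀ : TSeries) : dFirst (2 * DB 0 (MvPowerSeries.C F₀) +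
    2 * DB 1 (MvPowerSeries.C F₀)) = sumSeries (oddCoord F₀) := by
  refine ext_cf fun p q => ?_
  have hadd : ∀ F G : TSeries, dOdd 0 (F + G) = dOdd 0 F + dOdd 0 G := fun F G => map_add _ _ _
  rw [cf_dFirst, cf_add, hadd, cf_two_DB_zero_C, cf_two_DB_one_C, sumSeries, cf_ofCf]
  by_cases h1 : q = 0 ∧ 1 ≤ p
  · rw [if_pos h1, if_neg (by omega : ¬(p = 0 ∧ q % 2 = 1)), dOdd_zero_right, add_zero,
      oddCoord_pred F₀ h1.2]
    by_cases h : p % 2 = 1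
    · rw [if_pos ⟨h1.1, h⟩, if_pos h, dOdd_zero_smul]
    · rw [if_neg (by omega), if_neg h, dOdd_zero_right]
  · rw [if_neg h1, if_neg (by omega : ¬(q = 0 ∧ p % 2 = 1)), dOdd_zero_right, zero_add]
    by_cases h2 : p = 0 ∧ 1 ≤ q
    · rw [if_pos h2, oddCoord_pred F₀ h2.2]
      by_cases h : q % 2 = 1
      · rw [if_pos ⟨h2.1, h⟩, if_pos h, dOdd_zero_smul]
      · rw [if_neg (by omega), if_neg h, dOdd_zero_right]
    · rw [if_neg h2, if_neg (by omega), dOdd_zero_right]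

theorem oddCoord_odd (F₀ : TSeries) (g : ℕ) (hg : g % 2 = 1) : oddCoord F₀ g = 0 := by
  rw [oddCoord, if_neg (by omega)]

/-- In θΨ = L(w₀, w₁) - L(w₀, -w₁) the right side doubles the coefficients with odd exponent of w₁
and kills the others; parity of L disposes of even exponents of w₀. -/
theorem solvesDispersionlessBKP_iff (F₀ : TSeries) : SolvesDispersionlessBKP F₀ ↔
    ∀ n m : ℕ, ((2 * (n + m + 1) : ℕ) : TSeries) * secondF F₀ n m =
      cf (kernelL (oddCoord F₀)) (2 * n + 1) (2 * m + 1) := by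
  have hs := oddCoord_odd F₀
  have hΨ : cf (2 * DB 0 (2 * DB 1 (MvPowerSeries.C F₀))) 0 0 = 0 := by
    rw [cf_two_DB_two_DB_C, if_neg (by omega)]
  have h1 : SolvesDispersionlessBKP F₀ ↔
      theta (2 * DB 0 (2 * DB 1 (MvPowerSeries.C F₀))) =
        kernelL (oddCoord F₀) - signs flipOne (kernelL (oddCoord F₀)) := by
    rw [← kernelA_exp_iff _ _ hΨ, ← bkp_equation_iff hs, ← dFirst_add_eq, ← dFirst_sub_eq]
    rfl
  rw [h1]
  have hodd : ∀ n : ℕ, (2 * n + 1) % 2 = 1 := fun n => by omega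
  have hdiv : ∀ n : ℕ, (2 * n + 1) / 2 = n := fun n => by omega
  constructor
  · intro h n m
    have h2 := congrArg (fun F => cf F (2 * n + 1) (2 * m + 1)) h
    simp only [cf_theta, cf_sub, cf_signs_flipOne] at h2
    rw [cf_two_DB_two_DB_C, if_pos ⟨hodd n, hodd m⟩, hdiv, hdiv,
      Odd.neg_one_pow (Nat.odd_iff.2 (hodd m))] at h2
    rw [← sub_eq_zero]
    refine natCast_mul_eq_zero (n := 2) two_ne_zero ?_
    push_cast at h2 ⊢
    linear_combination h2
  · intro h
    refine ext_cf fun p q => ?_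
    rw [cf_theta, cf_sub, cf_signs_flipOne, cf_two_DB_two_DB_C]
    by_cases hq : q % 2 = 1
    · rw [Odd.neg_one_pow (Nat.odd_iff.2 hq)]
      by_cases hp : p % 2 = 1
      · rw [if_pos ⟨hp, hq⟩]
        have h2 := h (p / 2) (q / 2)
        have ep : 2 * (p / 2) + 1 = p := by omega
        have eq : 2 * (q / 2) + 1 = q := by omega
        have e : 2 * (p / 2 + q / 2 + 1) = p + q := by omega
        rw [ep, eq, e] at h2
        push_cast at h2
        linear_combination 2 * h2
      · rw [if_neg (by omega), kernelL_parity hs (by omega : (p + q) % 2 = 1)]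
        simp
    · rw [if_neg (by omega), Even.neg_one_pow (Nat.even_iff.2 (by omega))]
      simp

/-! ### The rescaling of the times -/

/-- The substitution `t_{2n+1} ↦ t_{n+1} / (2n+1)`. -/
abbrev rescaleTimes : TSeries →+* TSeries :=
  MvPowerSeries.rescale (fun n : ℕ => 1 / (2 * (n : ℂ) + 1))

theorem two_mul_add_one_ne_zero (n : ℕ) : 2 * (n : ℂ) + 1 ≠ 0 := by
  exact_mod_cast Nat.succ_ne_zero (2 * n)

theorem rescaleTimes_injective : Function.Injective rescaleTimes := by
  intro F G h
  ext d
  have h2 := congrArg (MvPowerSeries.coeff d) h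
  rw [rescaleTimes, MvPowerSeries.coeff_rescale, MvPowerSeries.coeff_rescale] at h2
  refine mul_left_cancel₀ ?_ h2
  rw [Finsupp.prod]
  exact Finset.prod_ne_zero_iff.2 fun n _ =>
    pow_ne_zero _ (one_div_ne_zero (two_mul_add_one_ne_zero n))

theorem rescaleTimes_smul (c : ℂ) (F : TSeries) : rescaleTimes (c • F) = c • rescaleTimes F := by
  ext d
  rw [rescaleTimes, MvPowerSeries.coeff_rescale, MvPowerSeries.coeff_smul, MvPowerSeries.coeff_smul,
    MvPowerSeries.coeff_rescale]
  ring

theorem pderiv_rescaleTimes (n : ℕ) (F : TSeries) : MvPowerSeries.pderiv ℂ n (rescaleTimes F) =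
    (1 / (2 * (n : ℂ) + 1)) • rescaleTimes (dOdd n F) := by
  ext d
  have h : (d + Finsupp.single n 1).prod (fun s m => (1 / (2 * (s : ℂ) + 1)) ^ m) =
      d.prod (fun s m => (1 / (2 * (s : ℂ) + 1)) ^ m) * (1 / (2 * (n : ℂ) + 1)) := by
    rw [Finsupp.prod_add_index' (h := fun (s : ℕ) (m : ℕ) => (1 / (2 * (s : ℂ) + 1)) ^ m)
      (fun i => pow_zero _) (fun i a b => pow_add _ a b),
      Finsupp.prod_single_index (h := fun (s : ℕ) (m : ℕ) => (1 / (2 * (s : ℂ) + 1)) ^ m)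
      (pow_zero _), pow_one]
  rw [rescaleTimes, MvPowerSeries.coeff_pderiv, MvPowerSeries.coeff_rescale,
    MvPowerSeries.coeff_smul, MvPowerSeries.coeff_rescale, dOdd, MvPowerSeries.coeff_pderiv, h]
  ring

theorem dT_dT_changeOfVariables (F₀ : TSeries) (n m : ℕ) :
    dT (n + 1) (dT (m + 1) (changeOfVariables F₀)) = rescaleTimes (secondF F₀ n m) := by
  rw [dT, dT, changeOfVariables, two_mul, map_add, ← two_mul, Nat.add_sub_cancel,
    Nat.add_sub_cancel, pderiv_rescaleTimes, two_mul_smul_eq, Derivation.map_smul,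
    pderiv_rescaleTimes, smul_smul, secondF, rescaleTimes_smul]
  congr 1
  have h1 := two_mul_add_one_ne_zero n
  have h2 := two_mul_add_one_ne_zero m
  field_simp

/-- Rescaling the times is an injective ring homomorphism carrying `secondF` to the second
derivatives of f, so it can be removed from the equations. -/
theorem solvesBHierarchy_iff (F₀ : TSeries) : SolvesBHierarchy (changeOfVariables F₀) ↔
    ∀ n m : ℕ, secondF F₀ n m = ∑ γ : Composition (n + 1 + (m + 1) - 1),
      RB (n + 1) (m + 1) γ.blocks • (γ.blocks.map fun g => secondF F₀ 0 (g - 1)).prod := by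
  have key : ∀ n m : ℕ, (dT (n + 1) (dT (m + 1) (changeOfVariables F₀)) =
      ∑ γ : Composition (n + 1 + (m + 1) - 1), RB (n + 1) (m + 1) γ.blocks •
        (γ.blocks.map fun g => dT 1 (dT g (changeOfVariables F₀))).prod) ↔
      secondF F₀ n m = ∑ γ : Composition (n + 1 + (m + 1) - 1), RB (n + 1) (m + 1) γ.blocks •
        (γ.blocks.map fun g => secondF F₀ 0 (g - 1)).prod := by
    intro n m
    have h : ∀ γ : Composition (n + 1 + (m + 1) - 1),
        rescaleTimes (RB (n + 1) (m + 1) γ.blocks •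
          (γ.blocks.map fun g => secondF F₀ 0 (g - 1)).prod) = RB (n + 1) (m + 1) γ.blocks •
        (γ.blocks.map fun g => dT 1 (dT g (changeOfVariables F₀))).prod := by
      intro γ
      rw [rescaleTimes_smul, map_list_prod, List.map_map]
      congr 2
      refine List.map_congr_left fun g hg => ?_
      have hg := γ.blocks_pos hg
      obtain ⟨k, rfl⟩ : ∃ k, g = k + 1 := ⟨g - 1, by omega⟩
      rw [Function.comp_apply, Nat.add_sub_cancel, ← dT_dT_changeOfVariables]
    rw [← Finset.sum_congr rfl fun γ _ => h γ, ← map_sum, dT_dT_changeOfVariables,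
      rescaleTimes_injective.eq_iff]
  constructor
  · intro h n m
    exact (key n m).1 (h (n + 1) (m + 1) (by omega) (by omega))
  · intro h α β hα hβ
    obtain ⟨n, rfl⟩ : ∃ n, α = n + 1 := ⟨α - 1, by omega⟩
    obtain ⟨m, rfl⟩ : ∃ m, β = m + 1 := ⟨β - 1, by omega⟩
    exact (key n m).2 (h n m)

theorem natCast_mul_sum_RB (F₀ : TSeries) (n m : ℕ) : ((2 * (n + m + 1) : ℕ) : TSeries) *
    ∑ γ : Composition (n + 1 + (m + 1) - 1), RB (n + 1) (m + 1) γ.blocks •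
      (γ.blocks.map fun g => secondF F₀ 0 (g - 1)).prod =
    cf (kernelL (oddCoord F₀)) (2 * n + 1) (2 * m + 1) := by
  -- With U(g) = f_{0,g-1}, the sequence required by `sum_RB` unfolds to `oddCoord`.
  have h := sum_RB (fun g => secondF F₀ 0 (g - 1)) (α := n + 1) (β := m + 1) (by omega) (by omega)
    (secondDerRec_kernelL (oddCoord F₀) _)
  rw [Nat.add_sub_cancel, Nat.add_sub_cancel] at h
  rw [← h, Algebra.smul_def]
  congr 1
  rw [← map_natCast (algebraMap ℂ TSeries)]
  congr 1
  push_cast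
  ring

end Frob

end

/-- Both systems give the same value for 2(n+m+1) f_{nm}, and the factor 2(n+m+1) can be cancelled
over ℂ. -/
theorem mainTheorem3 (F₀ : Frob.TSeries) :
    Frob.SolvesBHierarchy (Frob.changeOfVariables F₀) ↔ Frob.SolvesDispersionlessBKP F₀ := by
  rw [Frob.solvesBHierarchy_iff, Frob.solvesDispersionlessBKP_iff]
  refine forall_congr' fun n => forall_congr' fun m => ?_
  rw [← Frob.natCast_mul_sum_RB]
  refine ⟨fun h => by rw [← h], fun h => ?_⟩
  rw [← sub_eq_zero] at h ⊢
  rw [← mul_sub] at h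
  exact Frob.natCast_mul_eq_zero (by omega) h
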